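/- Let $\mathbb G\cong\mathbb R^{d_1}\oplus\mathbb R^{d_2}$ ($d_2\ge 1$) be a step-2 Carnot group in exponential coordinates: $V_1,\dots,V_{d_1}$ is a basis of the first layer of its Lie algebra, $[V_i,V_j]=w_{ij}\in\mathbb R^{d_2}$ with $w_{ij}=-w_{ji}$, the vectors $w_{ij}$ span the central second layer $\mathbb R^{d_2}$, and the group law is $$xy=\Big(x^{(1)}+y^{(1)},\;x^{(2)}+y^{(2)}+\tfrac12\sum_{i,j}w_{ij}\,x^{(1)}_iy^{(1)}_j\Big).$$ Let $d_{cc}$ be the Carnot–Carathéodory distance for which $V_1,\dots,V_{d_1}$ is an orthonormal frame of the horizontal bundle (the infimum of the lengths of absolutely continuous horizontal curves). Let $\boldsymbol\Omega=C_0([0,1],\mathbb G)$ be the space of continuous paths started from the origin, with the uniform topology, and write $\omega_{s,t}=\omega_s^{-1}\omega_t$. For $n\in\mathbb N$ and $t^n_k=k2^{-n}$ define the discretised cost $C_n:\boldsymbol\Omega\times\boldsymbol\Omega\to[0,\infty)$ by $$C_n(\omega,\bar\omega)^2=2^n\sum_{k=1}^{2^n}d_{cc}\big(\omega_{t^n_{k-1},t^n_k},\bar\omega_{t^n_{k-1},t^n_k}\big)^2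 .$$ For $x$ in the space $AC_0([0,1],\mathbb R^{d_1})$ of absolutely continuous paths started from the origin let $\Psi(x)_t=\big(x_t,\tfrac12\sum_{i,j}w_{ij}\int_0^t x^i_s\dot x^j_s\,ds\big)$ be its canonical lift. For $h\in AC_0$ let $T_h:\boldsymbol\Omega\to\boldsymbol\Omega$ be the shift $T_h\omega=\lim_n\Psi(\omega^n+h)$ (uniform limit), where $\omega^n\in AC_0$ and $\Psi(\omega^n)\to\omega$ uniformly. Let $\mathcal H=\{h\in AC_0:\|h\|_{\mathcal H}^2=\int_0^1|\dot h_t|^2dt<\infty\}$, and set $C_{\mathcal H}(\omega,\bar\omega)=\|h\|_{\mathcal H}$ if $\bar\omega=T_h\omega$ for some $h\in\mathcal H$, and $C_{\mathcal H}(\omega,\bar\omega)=+\infty$ otherwise. Let $\boldsymbol B=(\boldsymbol B_t)_{t\in[0,1]}$ be a Brownian motion on $\mathbb G$, i.e. a process with paths in $\boldsymbol\Omega$ such that $B=\boldsymbol B^{(1)}$ is a standard $d_1$-dimensional Brownian motion relative to some filtration and, for every $t\in[0,1]$, $\boldsymbol B^{(2)}_t=\tfrac12\sum_{i,j}w_{ij}\int_0^tB^i_s\,dB^j_s$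 almost surely (Itô integrals). (i) Suppose that $V_1$ is not central, i.e. $w_{1j}\ne0$ for some $j$, and let $h_t=(t,0,\dots,0)\in\mathbb R^{d_1}$ for $t\in[0,1]$. Then, almost surely, $$\lim_{n\to\infty}C_n(\boldsymbol B,T_h\boldsymbol B)=+\infty,$$ whereas $C_{\mathcal H}(\boldsymbol B,T_h\boldsymbol B)=1$. (ii) Consequently $C_n$ does not converge pointwise to $C_{\mathcal H}$: on every step-2 Carnot group $\mathbb G$ as above there are $\omega,\bar\omega\in\boldsymbol\Omega$ such that $C_n(\omega,\bar\omega)$ does not converge to $C_{\mathcal H}(\omega,\bar\omega)$ in $[0,\infty]$. -/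

import Mathlib

open MeasureTheory ProbabilityTheory Filter Topology
open scoped ENNReal NNReal unitInterval

noncomputable section

/-! ### Absolutely continuous paths in `ℝᵈ` and the Cameron-Martin norm -/

/-- The extension to `ℝ` (constant outside `[0,1]`) of a path on `[0,1]`; it is used only in order
to speak of derivatives and integrals in the time variable. -/
def pathExt {E : Type*} (x : I → E) : ℝ → E := Set.IccExtend zero_le_one x

/-- `AC₀([0,1], ℝᵈ)`: absolutely continuous paths started from the origin. -/
def ACPath (d : ℕ) : AddSubgroup C(I, EuclideanSpace ℝ (Fin d)) where
  carrier := {x | x 0 = 0 ∧ AbsolutelyContinuousOnInterval (pathExt x) 0 1}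
  zero_mem' := by
    refine ⟨rfl, LipschitzOnWith.absolutelyContinuousOnInterval (K := 0) ?_⟩
    intro s _ t _
    simp [pathExt, Set.IccExtend]
  add_mem' := by
    rintro x y ⟨hx, hx'⟩ ⟨hy, hy'⟩
    exact ⟨by simp [hx, hy], hx'.add hy'⟩
  neg_mem' := by
    rintro x ⟨hx, hx'⟩
    exact ⟨by simp [hx], hx'.neg⟩

/-- The path `h_t = (t, 0, …, 0)`. -/
def firstCoordPath (d : ℕ) [NeZero d] : ACPath d :=
  ⟨⟨fun t => EuclideanSpace.single 0 (t : ℝ), by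
      have h : (fun t : I => EuclideanSpace.single (0 : Fin d) (t : ℝ)) =
          fun t : I => (t : ℝ) • EuclideanSpace.single (0 : Fin d) (1 : ℝ) := by
        funext t
        ext i
        simp
      rw [h]
      fun_prop⟩, by
    refine ⟨by simp, LipschitzOnWith.absolutelyContinuousOnInterval (K := 1) ?_⟩
    refine LipschitzOnWith.of_dist_le_mul fun s _ t _ => ?_
    have := (LipschitzWith.projIcc (zero_le_one (α := ℝ))).dist_le_mul s t
    simpa [pathExt, Set.IccExtend, Subtype.dist_eq] using this⟩

/-- The Cameron-Martin space `ℋ`: absolutely continuous paths from the origin whose derivative is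
square integrable. -/
def cameronMartin (d : ℕ) : Set (ACPath d) :=
  {h | IntervalIntegrable (fun t => ‖deriv (pathExt h.1) t‖ ^ 2) volume 0 1}

/-- The Cameron-Martin norm `‖h‖_ℋ = (∫₀¹ |ḣ_t|² dt)^{1/2}`. -/
def cameronMartinNorm {d : ℕ} (h : ACPath d) : ℝ :=
  √(∫ t in (0 : ℝ)..1, ‖deriv (pathExt h.1) t‖ ^ 2)

/-- Integrability of `x^i ẋ^j` for an absolutely continuous path, needed for the continuity of the
canonical lift. -/
theorem ACPath.intervalIntegrable {d : ℕ} (x : ACPath d) (i j : Fin d) :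
    IntervalIntegrable (fun s => pathExt x.1 s i * deriv (pathExt x.1) s j) volume 0 1 := by
  have hc : Continuous (pathExt x.1) := x.1.continuous.Icc_extend'
  have hi : Continuous fun s => pathExt x.1 s i := by fun_prop
  have hjAC : AbsolutelyContinuousOnInterval (fun s => pathExt x.1 s j) 0 1 := by
    have hx : AbsolutelyContinuousOnInterval (pathExt x.1) 0 1 := x.2.2
    refine squeeze_zero (fun E => Finset.sum_nonneg fun _ _ => dist_nonneg) (fun E => ?_) hx
    refine Finset.sum_le_sum fun k _ => ?_
    rw [dist_eq_norm, dist_eq_norm]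
    exact PiLp.norm_apply_le (pathExt x.1 (E.2 k).1 - pathExt x.1 (E.2 k).2) j
  have hj : IntervalIntegrable (fun s => deriv (pathExt x.1) s j) volume 0 1 := by
    refine hjAC.intervalIntegrable_deriv.mono_fun ?_ (Eventually.of_forall fun s => ?_)
    · have hm : Measurable fun s => deriv (pathExt x.1) s j :=
        (by fun_prop : Measurable fun v : EuclideanSpace ℝ (Fin d) => v j).comp
          (measurable_deriv _)
      exact hm.aestronglyMeasurable
    · by_cases hd : DifferentiableAt ℝ (pathExt x.1) s
      · have := ((EuclideanSpace.proj (𝕜 := ℝ) j).hasFDerivAt.comp_hasDerivAt s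
          hd.hasDerivAt).deriv
        have h2 : deriv (fun s => pathExt x.1 s j) s = deriv (pathExt x.1) s j := this
        simp only [h2, le_refl]
      · simp [deriv_zero_of_not_differentiableAt hd]
  exact hj.continuousOn_mul hi.continuousOn

/-! ### Step-2 Carnot groups -/

/-- A step-2 Carnot group in exponential coordinates: on `𝔾 = ℝ^{d₁} ⊕ ℝ^{d₂}` the Lie algebra is
given by `[V_i, V_j] = w_{ij} ∈ ℝ^{d₂}` for the basis `V_1, …, V_{d₁}` of the first layer, the
second layer being central. The brackets span the second layer, which is not zero. -/
structure StepTwoCarnot (d₁ d₂ : ℕ) where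
  /-- The structure constants `w_{ij} = [V_i, V_j]`. -/
  w : Fin d₁ → Fin d₁ → EuclideanSpace ℝ (Fin d₂)
  skew : ∀ i j, w i j = - w j i
  span_eq_top : Submodule.span ℝ (Set.range fun p : Fin d₁ × Fin d₁ => w p.1 p.2) = ⊤
  pos : 0 < d₂

/-- The underlying space `ℝ^{d₁} ⊕ ℝ^{d₂}` of the group, with its usual topology. -/
abbrev CarnotSpace (d₁ d₂ : ℕ) : Type := EuclideanSpace ℝ (Fin d₁) × EuclideanSpace ℝ (Fin d₂)

namespace StepTwoCarnot

variable {d₁ d₂ : ℕ} (G : StepTwoCarnot d₁ d₂)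

/-- The bracket `[x, y] = ∑_{i,j} w_{ij} x_i y_j` of two first-layer vectors. -/
def bracket (x y : EuclideanSpace ℝ (Fin d₁)) : EuclideanSpace ℝ (Fin d₂) :=
  ∑ i, ∑ j, (x i * y j) • G.w i j

/-- The group law `x y = x + y + ½ [x, y]`. -/
def mul (x y : CarnotSpace d₁ d₂) : CarnotSpace d₁ d₂ :=
  (x.1 + y.1, x.2 + y.2 + (1 / 2 : ℝ) • G.bracket x.1 y.1)

/-- The inverse in the group; in exponential coordinates it is `-x`. -/
def inv (_G : StepTwoCarnot d₁ d₂) (x : CarnotSpace d₁ d₂) : CarnotSpace d₁ d₂ := -x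

/-- The value at `x` of the left-invariant vector field `V_i`, `i = 1, …, d₁`: the derivative at the
identity of the left multiplication by `x`, applied to the `i`-th basis vector. -/
def field (i : Fin d₁) (x : CarnotSpace d₁ d₂) : CarnotSpace d₁ d₂ :=
  fderiv ℝ (G.mul x) 0 (EuclideanSpace.single i 1, 0)

/-- The horizontal tangent space at `x`, spanned by `V_1(x), …, V_{d₁}(x)`. -/
def horizontalSpace (x : CarnotSpace d₁ d₂) : Submodule ℝ (CarnotSpace d₁ d₂) :=
  Submodule.span ℝ (Set.range fun i => G.field i x)

/-- A horizontal curve `γ : [0,1] → 𝔾` (values outside `[0,1]` are irrelevant). -/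
def IsHorizontal (γ : ℝ → CarnotSpace d₁ d₂) : Prop :=
  AbsolutelyContinuousOnInterval γ 0 1 ∧
    ∀ᵐ t ∂(volume.restrict (Set.Icc (0 : ℝ) 1)), deriv γ t ∈ G.horizontalSpace (γ t)

/-- The Carnot-Carathéodory distance. The left-invariant metric makes `V_1, …, V_{d₁}` orthonormal,
and a horizontal vector `v = ∑ᵢ cᵢ Vᵢ(x)` has first component `c`, so that `|v| = ‖v.1‖`. -/
def dcc (x y : CarnotSpace d₁ d₂) : ℝ :=
  sInf {L | ∃ γ : ℝ → CarnotSpace d₁ d₂, G.IsHorizontal γ ∧ γ 0 = x ∧ γ 1 = y ∧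
    L = ∫ t in (0 : ℝ)..1, ‖(deriv γ t).1‖}

/-- The space `C₀([0,1], 𝔾)` of continuous paths started from the origin. It carries the topology
of uniform convergence, which on a compact time interval is the compact-open topology and does not
depend on the metric chosen to induce the topology of `𝔾`. -/
abbrev PathSpace (_G : StepTwoCarnot d₁ d₂) : Type :=
  {ω : C(I, CarnotSpace d₁ d₂) // ω 0 = 0}

instance : Nonempty G.PathSpace := ⟨⟨0, rfl⟩⟩

/-- The increment `ω_{s,t} = ω_s⁻¹ ω_t`. -/
def increment (ω : G.PathSpace) (s t : I) : CarnotSpace d₁ d₂ :=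
  G.mul (G.inv (ω.1 s)) (ω.1 t)

/-- The canonical lift of an absolutely continuous path,
`Ψ(x)_t = (x_t, ½ ∑_{i,j} w_{ij} ∫₀ᵗ x^i_s ẋ^j_s ds)`. -/
def lift (x : ACPath d₁) : G.PathSpace :=
  ⟨⟨fun t => (x.1 t, (1 / 2 : ℝ) • ∑ i, ∑ j,
      (∫ s in (0 : ℝ)..t, pathExt x.1 s i * deriv (pathExt x.1) s j) • G.w i j), by
    have h (i j : Fin d₁) : Continuous fun t : I =>
        ∫ s in (0 : ℝ)..t, pathExt x.1 s i * deriv (pathExt x.1) s j := by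
      have hx := ACPath.intervalIntegrable x i j
      have := intervalIntegral.continuousOn_primitive_interval (μ := volume) (a := 0) (b := 1)
        (f := fun s => pathExt x.1 s i * deriv (pathExt x.1) s j)
        (by
          rw [Set.uIcc_of_le zero_le_one, integrableOn_Icc_iff_integrableOn_Ioc,
            ← intervalIntegrable_iff_integrableOn_Ioc_of_le zero_le_one]
          exact hx)
      rw [Set.uIcc_of_le zero_le_one] at this
      exact continuousOn_iff_continuous_domRestrict.1 this
    have hs : Continuous fun t : I => ∑ i, ∑ j,
        (∫ s in (0 : ℝ)..t, pathExt x.1 s i * deriv (pathExt x.1) s j) • G.w i j :=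
      continuous_finsetSum _ fun i _ => continuous_finsetSum _ fun j _ =>
        (h i j).smul continuous_const
    exact x.1.continuous.prodMk (hs.fun_const_smul _)⟩, by
    have h0 : x.1 0 = 0 := x.2.1
    simp [h0]⟩

/-- The shift `T_h ω = lim Ψ(x + h)`, the uniform limit as `x` ranges over absolutely continuous
paths whose canonical lifts `Ψ(x)` converge uniformly to `ω`. -/
def shift (h : ACPath d₁) (ω : G.PathSpace) : G.PathSpace :=
  limUnder (comap G.lift (𝓝 ω)) fun x => G.lift (x + h)

/-- The cost `C_ℋ(ω, η) = ‖h‖_ℋ` if `η = T_h ω` for some `h ∈ ℋ`, and `∞` otherwise. Such an `h` is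
unique (it is the difference of the first components of `η` and `ω`), so that the infimum below is
over at most one element. -/
def cost (ω η : G.PathSpace) : ℝ≥0∞ :=
  ⨅ h ∈ {h : ACPath d₁ | h ∈ cameronMartin d₁ ∧ η = G.shift h ω},
    ENNReal.ofReal (cameronMartinNorm h)

/-- The dyadic time `t^n_k = k 2⁻ⁿ`, for `k ≤ 2ⁿ`. -/
def dyadic (n k : ℕ) : I := Set.projIcc 0 1 zero_le_one ((k : ℝ) / 2 ^ n)

/-- The discretised cost
`C_n(ω, η) = (2ⁿ ∑_{k=1}^{2ⁿ} d_cc(ω_{t_{k-1},t_k}, η_{t_{k-1},t_k})²)^{1/2}`. -/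
def discCost (n : ℕ) (ω η : G.PathSpace) : ℝ :=
  √(2 ^ n * ∑ k ∈ Finset.range (2 ^ n),
    G.dcc (G.increment ω (dyadic n k) (dyadic n (k + 1)))
      (G.increment η (dyadic n k) (dyadic n (k + 1))) ^ 2)

end StepTwoCarnot

/-! ### Brownian motion and the Itô integral -/

section Stochastic

variable {Ω : Type*} {mΩ : MeasurableSpace Ω}

/-- `B` is a standard `d`-dimensional Brownian motion on `[0,1]` relative to the filtration `ℱ`. -/
structure IsStdBrownian {d : ℕ} (P : Measure Ω) (ℱ : Filtration I mΩ)
    (B : I → Ω → EuclideanSpace ℝ (Fin d)) : Prop where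
  adapted : ∀ t, Measurable[ℱ t] (B t)
  zero : ∀ ω, B 0 ω = 0
  continuous : ∀ ω, Continuous fun t => B t ω
  indep : ∀ s t, s ≤ t →
    Indep (MeasurableSpace.comap (fun ω => B t ω - B s ω) inferInstance) (ℱ s) P
  law : ∀ s t : I, s ≤ t → P.map (fun ω => B t ω - B s ω) =
    (stdGaussian (EuclideanSpace ℝ (Fin d))).map fun v => √((t : ℝ) - s) • v

/-- A bounded simple integrand `∑_{k<n} ξ_k 1_{(t_k, t_{k+1}]}` with `ξ_k` measurable at time
`t_k`. -/
structure SimpleIntegrand (ℱ : Filtration I mΩ) where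
  n : ℕ
  time : ℕ → I
  mono : Monotone time
  coef : ℕ → Ω → ℝ
  measurable : ∀ k, Measurable[ℱ (time k)] (coef k)
  bounded : ∀ k, ∃ C : ℝ, ∀ ω, |coef k ω| ≤ C

/-- The value of a simple integrand at time `s`. -/
def SimpleIntegrand.eval {ℱ : Filtration I mΩ} (H : SimpleIntegrand ℱ) (s : I) (ω : Ω) : ℝ :=
  ∑ k ∈ Finset.range H.n,
    (Set.Ioc (H.time k) (H.time (k + 1))).indicator (fun _ => H.coef k ω) s

/-- The stochastic integral `∫₀ᵗ H dβ` of a simple integrand. -/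
def SimpleIntegrand.integral {ℱ : Filtration I mΩ} (H : SimpleIntegrand ℱ) (β : I → Ω → ℝ) (t : I)
    (ω : Ω) : ℝ :=
  ∑ k ∈ Finset.range H.n,
    H.coef k ω * (β (min (H.time (k + 1)) t) ω - β (min (H.time k) t) ω)

/-- `Z = ∫₀ᵗ X dβ` in the sense of Itô: `Z` is the `L²(P)`-limit of the integrals of simple
integrands that converge to `X` in `L²(dP ⊗ ds)` on `[0,t]`. -/
def IsItoIntegral (P : Measure Ω) (ℱ : Filtration I mΩ) (X β : I → Ω → ℝ) (t : I)
    (Z : Ω → ℝ) : Prop :=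
  ∃ H : ℕ → SimpleIntegrand ℱ,
    Tendsto (fun n => ∫⁻ ω, (∫⁻ s in Set.Iic t, ‖X s ω - (H n).eval s ω‖ₑ ^ 2) ∂P) atTop (𝓝 0) ∧
    Tendsto (fun n => eLpNorm (fun ω => Z ω - (H n).integral β t ω) 2 P) atTop (𝓝 0)

/-- `Y` is a Brownian motion on the Carnot group: a process with paths in `C₀([0,1], 𝔾)` that solves
`dY = ∑ᵢ Vᵢ(Y) dBⁱ`, i.e. `Y⁽¹⁾ = B` is a standard Brownian motion on `ℝ^{d₁}` and
`Y⁽²⁾_t = ½ ∑_{i,j} w_{ij} ∫₀ᵗ Bⁱ dBʲ` almost surely, for every `t`. -/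
def StepTwoCarnot.IsBrownian {d₁ d₂ : ℕ} (G : StepTwoCarnot d₁ d₂) (P : Measure Ω)
    (ℱ : Filtration I mΩ) (Y : Ω → G.PathSpace) : Prop :=
  IsStdBrownian P ℱ (fun t ω => ((Y ω).1 t).1) ∧
    ∃ Z : Fin d₁ → Fin d₁ → I → Ω → ℝ,
      (∀ i j t, IsItoIntegral P ℱ (fun s ω => ((Y ω).1 s).1 i) (fun s ω => ((Y ω).1 s).1 j) t
        (Z i j t)) ∧
      ∀ t, ∀ᵐ ω ∂P, ((Y ω).1 t).2 = (1 / 2 : ℝ) • ∑ i, ∑ j, Z i j t ω • G.w i j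

end Stochastic

end

/-!
The two claims rest on the ball-box scaling of the Carnot-Carathéodory distance: `d_cc(x, y)²`
dominates the vertical component `vert x y` of `x⁻¹ y` (`StepTwoCarnot.norm_vert_le`). Along a
horizontal curve of length `L` that component moves with speed `½ [a - x⁽¹⁾, a']`, and
`|a - x⁽¹⁾| ≤ L`. Since the distance is an infimum of real numbers, the bound also needs that some
horizontal curve joins the two points (`StepTwoCarnot.exists_isHorizontal`); curves at rest near
both ends can be concatenated smoothly, and commutators of horizontal segments fill the centre.

The shift is defined by a limit over absolutely continuous paths `x` with `Ψ(x) → ω`. An integration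
by parts removes the derivative of `x` and shows `Ψ(x + h) = shiftMap h (Ψ(x))` with `shiftMap h`
continuous, so that the limit is `shiftMap h ω` as soon as the lifts are dense
(`StepTwoCarnot.mem_closure_range_lift`). Density comes from rapid rotations: a path that winds
around a small circle in the plane of `V_i, V_j` with angle `N² θ` converges uniformly to `0` while
its second component converges to a multiple of `θ w_{ij}`. The shift by `h` moves the first
component by `h`, hence `h` can be read off from `T_h ω` and the cost of `T_h ω` is `‖h‖`.

For `h_t = t v` the vertical discrepancy between the increments of `ω` and `T_h ω` over `[s, t]` is
`∫_s^t [v, ω⁽¹⁾_t - ω⁽¹⁾_r] dr` (`StepTwoCarnot.vert_increment_shift`). Along Brownian motion its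
components are Gaussian, independent over disjoint intervals and of order `(t - s)^{3/2}`, so that
`C_n²` is at least of order `2ⁿ · 2ⁿ · 2^{-3n/2} = 2^{n/2}`
(`IsStdBrownian.ae_tendsto_sum_abs_integral`). Independence enters only through cosines: by
`|x| ≥ 1 - cos x` it is enough to control averages of cosines of the normalised integrals, whose
first two moments follow from the characteristic function of the increments, applied to Riemann
sums. The variance of these averages is at most `2⁻ⁿ`, which is summable.

On smooth paths the same discrepancy is of order `(t - s)²`, and `C_n` stays bounded but keeps an
extra contribution. For `ω` the lift of `t ↦ c t e_j` with `c` large this already exceeds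
`‖h‖ = 1`, whence the absence of pointwise convergence on every group.
-/

noncomputable section

/-! ### The fundamental theorem of calculus for absolutely continuous paths in `ℝᵈ` -/

namespace AbsolutelyContinuousOnInterval

variable {d : ℕ} {f : ℝ → EuclideanSpace ℝ (Fin d)} {a b : ℝ}

theorem comp_lipschitz {X Y : Type*} [PseudoMetricSpace X] [PseudoMetricSpace Y] {f : ℝ → X}
    (hf : AbsolutelyContinuousOnInterval f a b) {g : X → Y} {K : ℝ≥0} (hg : LipschitzWith K g) :
    AbsolutelyContinuousOnInterval (fun t => g (f t)) a b := by
  have h0 := Tendsto.const_mul (K : ℝ) hf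
  rw [mul_zero] at h0
  refine squeeze_zero (fun E => Finset.sum_nonneg fun _ _ => dist_nonneg) (fun E => ?_) h0
  rw [Finset.mul_sum]
  exact Finset.sum_le_sum fun k _ => hg.dist_le_mul _ _

theorem coord (hf : AbsolutelyContinuousOnInterval f a b) (i : Fin d) :
    AbsolutelyContinuousOnInterval (fun t => f t i) a b :=
  hf.comp_lipschitz (EuclideanSpace.proj (𝕜 := ℝ) i).lipschitz

theorem ae_differentiableAt_euclidean (hf : AbsolutelyContinuousOnInterval f a b) :
    ∀ᵐ t, t ∈ Set.uIcc a b → DifferentiableAt ℝ f t := by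
  have h : ∀ᵐ t, ∀ i : Fin d, t ∈ Set.uIcc a b → DifferentiableAt ℝ (fun t => f t i) t :=
    ae_all_iff.2 fun i => (hf.coord i).ae_differentiableAt
  filter_upwards [h] with t ht hm
  exact differentiableAt_euclidean.2 fun i => ht i hm

theorem _root_.DifferentiableAt.deriv_coord {t : ℝ} (h : DifferentiableAt ℝ f t) (i : Fin d) :
    deriv (fun s => f s i) t = deriv f t i :=
  ((EuclideanSpace.proj (𝕜 := ℝ) i).hasFDerivAt.comp_hasDerivAt t h.hasDerivAt).deriv

theorem ae_deriv_coord (hf : AbsolutelyContinuousOnInterval f a b) (i : Fin d) :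
    ∀ᵐ t, t ∈ Set.uIoc a b → deriv (fun s => f s i) t = deriv f t i := by
  filter_upwards [hf.ae_differentiableAt_euclidean] with t ht hm
  exact (ht (Set.uIoc_subset_uIcc hm)).deriv_coord i

theorem intervalIntegrable_deriv_euclidean (hf : AbsolutelyContinuousOnInterval f a b) :
    IntervalIntegrable (deriv f) volume a b := by
  rw [intervalIntegrable_iff]
  refine Integrable.of_eval_piLp fun i => ?_
  rw [← IntegrableOn, ← intervalIntegrable_iff]
  exact (hf.coord i).intervalIntegrable_deriv.congr_ae
    ((ae_restrict_iff' measurableSet_uIoc).2 (hf.ae_deriv_coord i))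

theorem integral_deriv_eq_sub_euclidean (hf : AbsolutelyContinuousOnInterval f a b) :
    ∫ t in a..b, deriv f t = f b - f a := by
  ext i
  have h := (EuclideanSpace.proj (𝕜 := ℝ) i).intervalIntegral_comp_comm
    hf.intervalIntegrable_deriv_euclidean
  have h2 := (hf.coord i).integral_deriv_eq_sub
  rw [intervalIntegral.integral_congr_ae (hf.ae_deriv_coord i)] at h2
  exact h.symm.trans h2

end AbsolutelyContinuousOnInterval

namespace StepTwoCarnot

variable {d₁ d₂ : ℕ} (G : StepTwoCarnot d₁ d₂)

/-! ### The bracket and the horizontal bundle -/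

/-- The bracket of the first layer as a continuous bilinear map. -/
def bracketCLM : EuclideanSpace ℝ (Fin d₁) →L[ℝ] EuclideanSpace ℝ (Fin d₁) →L[ℝ]
    EuclideanSpace ℝ (Fin d₂) :=
  LinearMap.toContinuousBilinearMap (𝕜 := ℝ) <| LinearMap.mk₂ ℝ G.bracket
    (by
      intro x x' y
      simp only [bracket, PiLp.add_apply, add_mul, add_smul, Finset.sum_add_distrib])
    (by
      intro c x y
      simp only [bracket, PiLp.smul_apply, smul_eq_mul, Finset.smul_sum, smul_smul, mul_assoc])
    (by
      intro x y y'
      simp only [bracket, PiLp.add_apply, mul_add, add_smul, Finset.sum_add_distrib])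
    (by
      intro c x y
      simp only [bracket, PiLp.smul_apply, smul_eq_mul, Finset.smul_sum, smul_smul, mul_left_comm])

theorem bracketCLM_apply (x y : EuclideanSpace ℝ (Fin d₁)) : G.bracketCLM x y = G.bracket x y :=
  rfl

theorem bracketCLM_skew (x y : EuclideanSpace ℝ (Fin d₁)) :
    G.bracketCLM x y = -G.bracketCLM y x := by
  simp only [bracketCLM_apply, bracket]
  rw [Finset.sum_comm, ← Finset.sum_neg_distrib]
  refine Finset.sum_congr rfl fun j _ => ?_
  rw [← Finset.sum_neg_distrib]
  refine Finset.sum_congr rfl fun i _ => ?_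
  rw [G.skew i j, smul_neg, mul_comm]

@[simp]
theorem bracketCLM_self (x : EuclideanSpace ℝ (Fin d₁)) : G.bracketCLM x x = 0 := by
  have h := G.bracketCLM_skew x x
  have h2 : (2 : ℝ) • G.bracketCLM x x = 0 := by
    rw [two_smul]
    nth_rewrite 1 [h]
    exact neg_add_cancel _
  exact (smul_eq_zero.1 h2).resolve_left two_ne_zero

theorem bracketCLM_single (i j : Fin d₁) (a b : ℝ) :
    G.bracketCLM (EuclideanSpace.single i a) (EuclideanSpace.single j b) = (a * b) • G.w i j := by
  simp [bracketCLM_apply, bracket, PiLp.single_apply]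

theorem exists_w_ne_zero : ∃ i j, G.w i j ≠ 0 := by
  by_contra! h
  have hs := G.span_eq_top
  have h0 : Set.range (fun p : Fin d₁ × Fin d₁ => G.w p.1 p.2) ⊆ {0} := by
    rintro _ ⟨p, rfl⟩
    exact h p.1 p.2
  have hbot := (Submodule.span_mono h0 (R := ℝ)).antisymm' (hs ▸ le_top)
  have hd := G.pos
  have : Nonempty (Fin d₂) := ⟨⟨0, hd⟩⟩
  rw [Submodule.span_zero_singleton, hs] at hbot
  exact absurd hbot.symm top_ne_bot

theorem mul_eq (x y : CarnotSpace d₁ d₂) :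
    G.mul x y = (x.1 + y.1, x.2 + y.2 + (1 / 2 : ℝ) • G.bracketCLM x.1 y.1) := rfl

theorem field_eq (i : Fin d₁) (x : CarnotSpace d₁ d₂) :
    G.field i x = (EuclideanSpace.single i 1,
      (1 / 2 : ℝ) • G.bracketCLM x.1 (EuclideanSpace.single i 1)) := by
  have h1 : HasFDerivAt (fun y : CarnotSpace d₁ d₂ => x.1 + y.1)
      (ContinuousLinearMap.fst ℝ (EuclideanSpace ℝ (Fin d₁)) (EuclideanSpace ℝ (Fin d₂))) 0 :=
    hasFDerivAt_fst.const_add _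
  have h2 : HasFDerivAt
      (fun y : CarnotSpace d₁ d₂ => x.2 + y.2 + (1 / 2 : ℝ) • G.bracketCLM x.1 y.1)
      (ContinuousLinearMap.snd ℝ (EuclideanSpace ℝ (Fin d₁)) (EuclideanSpace ℝ (Fin d₂)) +
        (1 / 2 : ℝ) • (G.bracketCLM x.1).comp
          (ContinuousLinearMap.fst ℝ (EuclideanSpace ℝ (Fin d₁)) (EuclideanSpace ℝ (Fin d₂)))) 0 :=
    (hasFDerivAt_snd.const_add _).add
      (((G.bracketCLM x.1).hasFDerivAt.comp (0 : CarnotSpace d₁ d₂) hasFDerivAt_fst).const_smul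
        (1 / 2 : ℝ))
  have h := h1.prodMk h2
  rw [field, show G.mul x = fun y : CarnotSpace d₁ d₂ =>
    (x.1 + y.1, x.2 + y.2 + (1 / 2 : ℝ) • G.bracketCLM x.1 y.1) from rfl, h.fderiv]
  simp

theorem mem_horizontalSpace_iff {x v : CarnotSpace d₁ d₂} :
    v ∈ G.horizontalSpace x ↔ v.2 = (1 / 2 : ℝ) • G.bracketCLM x.1 v.1 := by
  constructor
  · intro h
    induction h using Submodule.span_induction with
    | mem v hv =>
      obtain ⟨i, rfl⟩ := hv
      simp [field_eq]
    | zero => simp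
    | add v w _ _ hv hw => simp [hv, hw]
    | smul c v _ hv => simp [hv, smul_comm c]
  · intro h
    have hv : v = ∑ i, v.1 i • G.field i x := by
      have h1 : ∑ i, v.1 i • EuclideanSpace.single i (1 : ℝ) = v.1 := by
        simpa using (EuclideanSpace.basisFun (Fin d₁) ℝ).sum_repr v.1
      refine Prod.ext ?_ ?_
      · rw [Prod.fst_sum]
        simp only [field_eq, Prod.smul_fst]
        exact h1.symm
      · rw [h, Prod.snd_sum]
        conv_lhs => rw [← h1]
        simp only [field_eq, map_sum, map_smul, Finset.smul_sum, Prod.smul_snd]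
        exact Finset.sum_congr rfl fun i _ => smul_comm _ _ _
    rw [hv]
    exact Submodule.sum_mem _ fun i _ =>
      Submodule.smul_mem _ _ (Submodule.subset_span ⟨i, rfl⟩)

/-! ### Every two points are joined by a horizontal curve -/

/-- `g` is the end point of a `C¹` horizontal curve `(a, b)` that rests at the origin before time
`0` and at `g` after time `1`. The rests let such curves be concatenated without losing
regularity. -/
def IsReachable (g : CarnotSpace d₁ d₂) : Prop :=
  ∃ (a : ℝ → EuclideanSpace ℝ (Fin d₁)) (b : ℝ → EuclideanSpace ℝ (Fin d₂)),
    ContDiff ℝ 1 a ∧ ContDiff ℝ 1 b ∧ (∀ t ≤ 0, a t = 0 ∧ b t = 0) ∧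
    (∀ t ≥ 1, a t = g.1 ∧ b t = g.2) ∧
    ∀ t, deriv b t = (1 / 2 : ℝ) • G.bracketCLM (a t) (deriv a t)

variable {G}

theorem IsReachable.mul {g g' : CarnotSpace d₁ d₂} (hg : G.IsReachable g)
    (hg' : G.IsReachable g') : G.IsReachable (G.mul g g') := by
  obtain ⟨a, b, ha, hb, h0, h1, hd⟩ := hg
  obtain ⟨a', b', ha', hb', h0', h1', hd'⟩ := hg'
  have hA : ContDiff ℝ 1 fun t : ℝ => a (2 * t) := ha.comp (contDiff_const.mul contDiff_id)
  have hA' : ContDiff ℝ 1 fun t : ℝ => a' (2 * t - 1) :=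
    ha'.comp ((contDiff_const.mul contDiff_id).sub contDiff_const)
  have hB : ContDiff ℝ 1 fun t : ℝ => b (2 * t) := hb.comp (contDiff_const.mul contDiff_id)
  have hB' : ContDiff ℝ 1 fun t : ℝ => b' (2 * t - 1) :=
    hb'.comp ((contDiff_const.mul contDiff_id).sub contDiff_const)
  refine ⟨fun t => a (2 * t) + a' (2 * t - 1),
    fun t => b (2 * t) + b' (2 * t - 1) +
      (1 / 2 : ℝ) • G.bracketCLM (a (2 * t)) (a' (2 * t - 1)), hA.add hA', ?_, ?_, ?_, ?_⟩
  · have hC : ContDiff ℝ 1 fun t : ℝ => G.bracketCLM (a (2 * t)) (a' (2 * t - 1)) :=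
      (G.bracketCLM.contDiff.comp hA).clm_apply hA'
    exact (hB.add hB').add (hC.const_smul (1 / 2 : ℝ))
  · intro t ht
    simp [h0 (2 * t) (by linarith), h0' (2 * t - 1) (by linarith)]
  · intro t ht
    simp [h1 (2 * t) (by linarith), h1' (2 * t - 1) (by linarith), mul_eq]
  · intro t
    have e1 : HasDerivAt (fun t : ℝ => 2 * t) 2 t := by simpa using (hasDerivAt_id t).const_mul 2
    have e2 : HasDerivAt (fun t : ℝ => 2 * t - 1) 2 t := e1.sub_const 1
    have dA := (ha.differentiable one_ne_zero (2 * t)).hasDerivAt.scomp t e1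
    have dA' := (ha'.differentiable one_ne_zero (2 * t - 1)).hasDerivAt.scomp t e2
    have dB := (hb.differentiable one_ne_zero (2 * t)).hasDerivAt.scomp t e1
    have dB' := (hb'.differentiable one_ne_zero (2 * t - 1)).hasDerivAt.scomp t e2
    have dAA := (G.bracketCLM.hasFDerivAt.comp_hasDerivAt t dA).clm_apply dA'
    -- The two curves never move at the same time.
    have hz : G.bracketCLM (deriv a (2 * t)) (a' (2 * t - 1)) = 0 := by
      rcases le_total (2 * t) 1 with h | h
      · simp [h0' (2 * t - 1) (by linarith)]
      · have : deriv a (2 * t) = 0 := by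
          have hc : HasDerivWithinAt a 0 (Set.Ici (2 * t)) (2 * t) :=
            (hasDerivWithinAt_const _ _ g.1).congr
              (fun s hs => (h1 s (h.trans hs)).1) (h1 _ h).1
          exact (uniqueDiffWithinAt_Ici _).eq_deriv _
            (ha.differentiable one_ne_zero (2 * t)).hasDerivAt.hasDerivWithinAt hc
        simp [this]
    have hz' : G.bracketCLM (a' (2 * t - 1)) (deriv a (2 * t)) = 0 := by
      rw [G.bracketCLM_skew, hz, neg_zero]
    have H := ((dB.add dB').add (dAA.const_smul (1 / 2 : ℝ))).deriv
    have HA := (dA.add dA').deriv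
    simp only [Function.comp_def, Pi.add_def, Pi.smul_def] at H HA
    rw [HA]
    refine H.trans ?_
    simp only [hd, hd', map_add, map_smul, add_apply,
      smul_apply, hz, hz', smul_add, smul_zero, add_zero, zero_add]
    module

variable (G)

theorem isReachable_horizontal (v : EuclideanSpace ℝ (Fin d₁)) : G.IsReachable (v, 0) := by
  refine ⟨fun t => Real.smoothTransition t • v, fun _ => 0,
    Real.smoothTransition.contDiff.smul contDiff_const, contDiff_const, fun t ht => ?_,
    fun t ht => ?_, fun t => ?_⟩
  · simp [Real.smoothTransition.zero_of_nonpos ht]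
  · simp [Real.smoothTransition.one_of_one_le ht]
  · have h := (((Real.smoothTransition.contDiff (n := 1)).differentiable
      (by simp) t).hasDerivAt.smul_const v).deriv
    rw [h]
    simp

theorem isReachable_central (z : EuclideanSpace ℝ (Fin d₂)) : G.IsReachable (0, z) := by
  have hz : z ∈ Submodule.span ℝ (Set.range fun p : Fin d₁ × Fin d₁ => G.w p.1 p.2) :=
    G.span_eq_top ▸ Submodule.mem_top
  -- The property has to be proved for all multiples at once, since it is not visibly homogeneous.
  suffices h : ∀ c : ℝ, G.IsReachable (0, c • z) by simpa using h 1
  induction hz using Submodule.span_induction with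
  | mem z hz =>
    obtain ⟨⟨i, j⟩, rfl⟩ := hz
    intro c
    have h := (((G.isReachable_horizontal (EuclideanSpace.single i c)).mul
      (G.isReachable_horizontal (EuclideanSpace.single j 1))).mul
      (G.isReachable_horizontal (-EuclideanSpace.single i c))).mul
      (G.isReachable_horizontal (-EuclideanSpace.single j 1))
    convert h using 1
    have hs : G.bracketCLM (EuclideanSpace.single j (1 : ℝ)) (EuclideanSpace.single i c) =
        -(c • G.w i j) := by
      rw [G.bracketCLM_skew, G.bracketCLM_single]
      simp
    have hs' := G.bracketCLM_single i j c 1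
    rw [mul_one] at hs'
    simp only [mul_eq, Prod.mk.injEq]
    refine ⟨by abel, ?_⟩
    simp only [map_add, map_neg, add_apply, neg_apply,
      bracketCLM_self, hs, hs']
    module
  | zero =>
    intro c
    simpa using! G.isReachable_horizontal 0
  | add x y _ _ hx hy =>
    intro c
    convert (hx c).mul (hy c) using 1
    simp [mul_eq]
  | smul r x _ hx =>
    intro c
    simpa [smul_smul] using hx (c * r)

/-- A special case of Chow's theorem. -/
theorem exists_isHorizontal (x y : CarnotSpace d₁ d₂) :
    ∃ γ : ℝ → CarnotSpace d₁ d₂, G.IsHorizontal γ ∧ γ 0 = x ∧ γ 1 = y := by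
  obtain ⟨a, b, ha, hb, h0, h1, hd⟩ : G.IsReachable (G.mul (G.inv x) y) := by
    convert (G.isReachable_horizontal (y.1 - x.1)).mul (G.isReachable_central
      (y.2 - x.2 - (1 / 2 : ℝ) • G.bracketCLM x.1 y.1)) using 1
    simp only [mul_eq, inv, Prod.mk.injEq, Prod.fst_neg, Prod.snd_neg, map_zero, map_neg,
      neg_apply]
    exact ⟨by abel, by module⟩
  have hγ : ContDiff ℝ 1 fun t => G.mul x (a t, b t) := by
    have : ContDiff ℝ 1 fun t => G.bracketCLM x.1 (a t) := (G.bracketCLM x.1).contDiff.comp ha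
    exact (contDiff_const.add ha).prodMk
      ((contDiff_const.add hb).add (this.const_smul (1 / 2 : ℝ)))
  refine ⟨fun t => G.mul x (a t, b t), ⟨hγ.contDiffOn.absolutelyContinuousOnInterval, ?_⟩, ?_, ?_⟩
  · refine Eventually.of_forall fun t => ?_
    have dA := (ha.differentiable one_ne_zero t).hasDerivAt
    have dB := (hb.differentiable one_ne_zero t).hasDerivAt
    have D := (dA.const_add x.1).prodMk ((dB.const_add x.2).add
      (((G.bracketCLM x.1).hasFDerivAt.comp_hasDerivAt t dA).const_smul (1 / 2 : ℝ)))
    have D' : deriv (fun t => G.mul x (a t, b t)) t = _ := D.deriv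
    rw [D', mem_horizontalSpace_iff]
    simp only [mul_eq, hd, map_add, add_apply, smul_add]
    abel
  · simp [h0 0 le_rfl, mul_eq]
  · simp only [h1 1 le_rfl, mul_eq, inv, Prod.fst_neg, Prod.snd_neg, map_neg, map_add,
      neg_apply, bracketCLM_self]
    refine Prod.ext (by simp) ?_
    beta_reduce
    module

/-! ### A lower bound for the Carnot-Carathéodory distance -/

/-- The vertical component of `x⁻¹ y`. -/
def vert (x y : CarnotSpace d₁ d₂) : EuclideanSpace ℝ (Fin d₂) :=
  y.2 - x.2 - (1 / 2 : ℝ) • G.bracketCLM x.1 y.1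

/-- Along a horizontal curve `γ = (a, b)` of length `L` from `x`, the vertical component of
`x⁻¹ γ` moves with speed `½ [a - x⁽¹⁾, a']`, and `|a - x⁽¹⁾| ≤ L`. -/
theorem norm_vert_le_of_isHorizontal {γ : ℝ → CarnotSpace d₁ d₂} (hγ : G.IsHorizontal γ) :
    ‖G.vert (γ 0) (γ 1)‖ ≤ ‖G.bracketCLM‖ / 2 * (∫ t in (0 : ℝ)..1, ‖(deriv γ t).1‖) ^ 2 := by
  obtain ⟨hac, hhor⟩ := hγ
  have ha : AbsolutelyContinuousOnInterval (fun t => (γ t).1) 0 1 :=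
    hac.comp_lipschitz LipschitzWith.prod_fst
  have hb : AbsolutelyContinuousOnInterval (fun t => (γ t).2) 0 1 :=
    hac.comp_lipschitz LipschitzWith.prod_snd
  have hc : AbsolutelyContinuousOnInterval
      (fun t => (1 / 2 : ℝ) • G.bracketCLM (γ 0).1 (γ t).1) 0 1 :=
    (ha.comp_lipschitz (G.bracketCLM (γ 0).1).lipschitz).const_smul _
  have hg := hb.sub hc
  have hI : Set.uIcc (0 : ℝ) 1 = Set.Icc 0 1 := Set.uIcc_of_le zero_le_one
  have hd : ∀ᵐ t, t ∈ Set.Icc (0 : ℝ) 1 → DifferentiableAt ℝ γ t := by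
    filter_upwards [ha.ae_differentiableAt_euclidean, hb.ae_differentiableAt_euclidean]
      with t h1 h2 ht
    exact (h1 (hI ▸ ht)).prodMk (h2 (hI ▸ ht))
  have hda : ∀ᵐ t, t ∈ Set.Icc (0 : ℝ) 1 →
      deriv (fun t => (γ t).1) t = (deriv γ t).1 := by
    filter_upwards [hd] with t h ht
    exact (hasFDerivAt_fst.comp_hasDerivAt t (h ht).hasDerivAt).deriv
  set L := ∫ t in (0 : ℝ)..1, ‖(deriv γ t).1‖ with hL
  have hLa : L = ∫ t in (0 : ℝ)..1, ‖deriv (fun t => (γ t).1) t‖ := by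
    refine intervalIntegral.integral_congr_ae ?_
    filter_upwards [hda] with t h ht
    rw [h (hI ▸ Set.uIoc_subset_uIcc ht)]
  have hint := ha.intervalIntegrable_deriv_euclidean.norm
  have hle : ∀ t ∈ Set.Icc (0 : ℝ) 1, ‖(γ t).1 - (γ 0).1‖ ≤ L := by
    intro t ht
    rw [← (ha.mono (Set.uIcc_subset_uIcc_left (hI ▸ ht))).integral_deriv_eq_sub_euclidean, hLa]
    refine (intervalIntegral.norm_integral_le_integral_norm ht.1).trans ?_
    exact intervalIntegral.integral_mono_interval le_rfl ht.1 ht.2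
      (Eventually.of_forall fun _ => norm_nonneg _) hint
  have hz : G.vert (γ 0) (γ 1) = ∫ t in (0 : ℝ)..1, (1 / 2 : ℝ) •
      G.bracketCLM ((γ t).1 - (γ 0).1) (deriv (fun t => (γ t).1) t) := by
    have h1 := hg.integral_deriv_eq_sub_euclidean
    have h2 : G.vert (γ 0) (γ 1) = ((fun t => (γ t).2) -
        fun t => (1 / 2 : ℝ) • G.bracketCLM (γ 0).1 (γ t).1) 1 - ((fun t => (γ t).2) -
        fun t => (1 / 2 : ℝ) • G.bracketCLM (γ 0).1 (γ t).1) 0 := by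
      simp only [vert, Pi.sub_apply, bracketCLM_self]
      module
    rw [h2, ← h1]
    refine intervalIntegral.integral_congr_ae ?_
    rw [ae_restrict_iff' measurableSet_Icc] at hhor
    filter_upwards [hd, hda, hhor] with t h1 h2 h3 ht
    have ht' : t ∈ Set.Icc (0 : ℝ) 1 := hI ▸ Set.uIoc_subset_uIcc ht
    have D := (h1 ht').hasDerivAt
    have DA : HasDerivAt (fun t => (γ t).1) (deriv γ t).1 t :=
      (hasFDerivAt_fst (p := γ t)).comp_hasDerivAt t D
    have DB : HasDerivAt (fun t => (γ t).2) (deriv γ t).2 t :=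
      (hasFDerivAt_snd (p := γ t)).comp_hasDerivAt t D
    have DC := (DB.sub
      (((G.bracketCLM (γ 0).1).hasFDerivAt.comp_hasDerivAt t DA).const_smul (1 / 2 : ℝ))).deriv
    have h3' := G.mem_horizontalSpace_iff.1 (h3 ht')
    refine DC.trans ?_
    rw [h3', h2 ht', map_sub, sub_apply, smul_sub]
  rw [hz]
  have hB : ∀ t ∈ Set.Ioc (0 : ℝ) 1, ‖(1 / 2 : ℝ) •
      G.bracketCLM ((γ t).1 - (γ 0).1) (deriv (fun t => (γ t).1) t)‖ ≤
        ‖G.bracketCLM‖ / 2 * L * ‖deriv (fun t => (γ t).1) t‖ := by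
    intro t ht
    rw [norm_smul]
    have h1 := G.bracketCLM.le_opNorm₂ ((γ t).1 - (γ 0).1) (deriv (fun t => (γ t).1) t)
    have h2 := hle t ⟨ht.1.le, ht.2⟩
    have h3 : ‖G.bracketCLM‖ * ‖(γ t).1 - (γ 0).1‖ * ‖deriv (fun t => (γ t).1) t‖ ≤
        ‖G.bracketCLM‖ * L * ‖deriv (fun t => (γ t).1) t‖ := by gcongr
    have h4 : ‖(1 / 2 : ℝ)‖ = 1 / 2 := by norm_num
    rw [h4]
    linarith
  refine (intervalIntegral.norm_integral_le_of_norm_le zero_le_one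
    (Eventually.of_forall hB) (hint.const_mul _)).trans_eq ?_
  rw [intervalIntegral.integral_const_mul, ← hLa]
  ring

theorem norm_vert_le (x y : CarnotSpace d₁ d₂) :
    ‖G.vert x y‖ ≤ ‖G.bracketCLM‖ / 2 * G.dcc x y ^ 2 := by
  have hne : {L | ∃ γ : ℝ → CarnotSpace d₁ d₂, G.IsHorizontal γ ∧ γ 0 = x ∧ γ 1 = y ∧
      L = ∫ t in (0 : ℝ)..1, ‖(deriv γ t).1‖}.Nonempty := by
    obtain ⟨γ, h, h0, h1⟩ := G.exists_isHorizontal x y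
    exact ⟨_, γ, h, h0, h1, rfl⟩
  -- The bound passes to the infimum because its right-hand side is continuous in the length.
  have hlim : Tendsto (fun r : ℝ => ‖G.bracketCLM‖ / 2 * r ^ 2) (𝓝[>] G.dcc x y)
      (𝓝 (‖G.bracketCLM‖ / 2 * G.dcc x y ^ 2)) :=
    tendsto_nhdsWithin_of_tendsto_nhds (((continuous_pow 2).tendsto _).const_mul _)
  refine ge_of_tendsto hlim ?_
  filter_upwards [self_mem_nhdsWithin] with r hr
  obtain ⟨L, ⟨γ, h, rfl, rfl, rfl⟩, hlt⟩ := exists_lt_of_csInf_lt hne hr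
  refine (G.norm_vert_le_of_isHorizontal h).trans ?_
  have h0 : 0 ≤ ∫ t in (0 : ℝ)..1, ‖(deriv γ t).1‖ :=
    intervalIntegral.integral_nonneg zero_le_one fun _ _ => norm_nonneg _
  gcongr

theorem norm_bracketCLM_pos : 0 < ‖G.bracketCLM‖ := by
  obtain ⟨i, j, h⟩ := G.exists_w_ne_zero
  have hle := G.bracketCLM.le_opNorm₂ (EuclideanSpace.single i 1) (EuclideanSpace.single j 1)
  rw [G.bracketCLM_single] at hle
  simp only [mul_one, one_smul, PiLp.norm_single, norm_one] at hle
  exact (norm_pos_iff.2 h).trans_le hle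

end StepTwoCarnot

/-! ### Calculus of absolutely continuous paths -/

theorem AbsolutelyContinuousOnInterval.bilin {E F H : Type*} [NormedAddCommGroup E]
    [NormedSpace ℝ E] [NormedAddCommGroup F] [NormedSpace ℝ F] [NormedAddCommGroup H]
    [NormedSpace ℝ H] (L : E →L[ℝ] F →L[ℝ] H) {f : ℝ → E} {g : ℝ → F} {a b : ℝ}
    (hf : AbsolutelyContinuousOnInterval f a b) (hg : AbsolutelyContinuousOnInterval g a b) :
    AbsolutelyContinuousOnInterval (fun t => L (f t) (g t)) a b := by
  obtain ⟨C, hC⟩ := hf.exists_bound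
  obtain ⟨D, hD⟩ := hg.exists_bound
  have h0 := (Tendsto.const_mul (‖L‖ * D) hf).add (Tendsto.const_mul (‖L‖ * C) hg)
  rw [mul_zero, mul_zero, add_zero] at h0
  refine squeeze_zero' (Eventually.of_forall fun E => Finset.sum_nonneg fun _ _ => dist_nonneg)
    ?_ h0
  filter_upwards [mem_inf_of_right (mem_principal_self _)] with E hE
  rw [Finset.mul_sum, Finset.mul_sum, ← Finset.sum_add_distrib]
  refine Finset.sum_le_sum fun k hk => ?_
  obtain ⟨h1, h2⟩ := hE.1 k hk
  rw [dist_eq_norm, dist_eq_norm, dist_eq_norm]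
  have he : L (f (E.2 k).1) (g (E.2 k).1) - L (f (E.2 k).2) (g (E.2 k).2) =
      L (f (E.2 k).1 - f (E.2 k).2) (g (E.2 k).1) +
        L (f (E.2 k).2) (g (E.2 k).1 - g (E.2 k).2) := by
    simp
  rw [he]
  refine (norm_add_le _ _).trans (add_le_add ?_ ?_)
  · refine (L.le_opNorm₂ _ _).trans ?_
    have := hD _ h1
    calc _ ≤ ‖L‖ * ‖f (E.2 k).1 - f (E.2 k).2‖ * D := by gcongr
      _ = _ := by ring
  · refine (L.le_opNorm₂ _ _).trans ?_
    have := hC _ h2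
    gcongr

theorem pathExt_apply {E : Type*} (x : I → E) (t : I) : pathExt x t = x t :=
  Set.IccExtend_val _ _ _

theorem continuous_pathExt {E : Type*} [TopologicalSpace E] (x : C(I, E)) :
    Continuous (pathExt x) := x.continuous.Icc_extend'

theorem pathExt_add {E : Type*} [TopologicalSpace E] [Add E] [ContinuousAdd E] (x y : C(I, E)) :
    pathExt (x + y) = fun t => pathExt x t + pathExt y t := rfl

namespace ACPath

variable {d : ℕ}

theorem intervalIntegrable_deriv (x : ACPath d) :
    IntervalIntegrable (deriv (pathExt x.1)) volume 0 1 :=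
  x.2.2.intervalIntegrable_deriv_euclidean

/-- A continuously differentiable path from the origin is absolutely continuous. -/
def ofContDiff (X : ℝ → EuclideanSpace ℝ (Fin d)) (hX : ContDiff ℝ 1 X) (h0 : X 0 = 0) :
    ACPath d :=
  ⟨⟨fun t => X t, hX.continuous.comp continuous_subtype_val⟩, h0, by
    refine ContDiffOn.absolutelyContinuousOnInterval (hX.contDiffOn.congr fun t ht => ?_)
    rw [Set.uIcc_of_le zero_le_one] at ht
    exact Set.IccExtend_of_mem _ _ ht⟩

variable {X : ℝ → EuclideanSpace ℝ (Fin d)} (hX : ContDiff ℝ 1 X) (h0 : X 0 = 0)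

@[simp]
theorem ofContDiff_apply (t : I) : (ofContDiff X hX h0).1 t = X t := rfl

theorem pathExt_ofContDiff {t : ℝ} (ht : t ∈ Set.Icc (0 : ℝ) 1) :
    pathExt (ofContDiff X hX h0).1 t = X t :=
  Set.IccExtend_of_mem _ _ ht

theorem deriv_pathExt_ofContDiff {t : ℝ} (ht : t ∈ Set.Ioo (0 : ℝ) 1) :
    deriv (pathExt (ofContDiff X hX h0).1) t = deriv X t := by
  refine EventuallyEq.deriv_eq ?_
  filter_upwards [Ioo_mem_nhds ht.1 ht.2] with s hs
  exact pathExt_ofContDiff hX h0 ⟨hs.1.le, hs.2.le⟩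

theorem ae_deriv_pathExt_ofContDiff (t : I) : ∀ᵐ s : ℝ, s ∈ Set.uIoc 0 (t : ℝ) →
    deriv (pathExt (ofContDiff X hX h0).1) s = deriv X s := by
  filter_upwards [compl_mem_ae_iff.2 (measure_singleton (1 : ℝ))] with s hs1 hs
  rw [Set.uIoc_of_le t.2.1] at hs
  exact deriv_pathExt_ofContDiff hX h0 ⟨hs.1, lt_of_le_of_ne (hs.2.trans t.2.2) hs1⟩

end ACPath

/-- The path `t ↦ t v`. -/
def linPath {d : ℕ} (v : EuclideanSpace ℝ (Fin d)) : ACPath d :=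
  ACPath.ofContDiff (fun t => t • v) (contDiff_id.smul contDiff_const) (zero_smul _ _)

@[simp]
theorem linPath_apply {d : ℕ} (v : EuclideanSpace ℝ (Fin d)) (t : I) :
    (linPath v).1 t = (t : ℝ) • v := rfl

theorem firstCoordPath_eq (d : ℕ) [NeZero d] :
    firstCoordPath d = linPath (EuclideanSpace.single 0 1) := by
  refine Subtype.ext (ContinuousMap.ext fun t => ?_)
  change EuclideanSpace.single 0 (t : ℝ) = (t : ℝ) • EuclideanSpace.single 0 (1 : ℝ)
  ext i
  simp

theorem deriv_smul_const_id {d : ℕ} (v : EuclideanSpace ℝ (Fin d)) (t : ℝ) :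
    deriv (fun s : ℝ => s • v) t = v := by
  simpa using ((hasDerivAt_id t).smul_const v).deriv

theorem ae_deriv_linPath {d : ℕ} (v : EuclideanSpace ℝ (Fin d)) (t : I) :
    ∀ᵐ s : ℝ, s ∈ Set.uIoc 0 (t : ℝ) → deriv (pathExt (linPath v).1) s = v := by
  filter_upwards [ACPath.ae_deriv_pathExt_ofContDiff (X := fun s : ℝ => s • v)
    (contDiff_id.smul contDiff_const) (zero_smul _ _) t] with s hs hm
  exact (hs hm).trans (deriv_smul_const_id v s)

theorem linPath_mem_cameronMartin {d : ℕ} (v : EuclideanSpace ℝ (Fin d)) :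
    linPath v ∈ cameronMartin d := by
  refine (intervalIntegrable_const (c := ‖v‖ ^ 2)).congr_ae
    ((ae_restrict_iff' measurableSet_uIoc).2 ?_)
  filter_upwards [ae_deriv_linPath v 1] with s hs hm
  rw [hs hm]

theorem cameronMartinNorm_linPath {d : ℕ} (v : EuclideanSpace ℝ (Fin d)) :
    cameronMartinNorm (linPath v) = ‖v‖ := by
  have h : ∫ t in (0 : ℝ)..1, ‖deriv (pathExt (linPath v).1) t‖ ^ 2 =
      ∫ _ in (0 : ℝ)..1, ‖v‖ ^ 2 := by
    refine intervalIntegral.integral_congr_ae ?_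
    filter_upwards [ae_deriv_linPath v 1] with s hs hm
    rw [hs hm]
  rw [cameronMartinNorm, h]
  simp

namespace StepTwoCarnot

variable {d₁ d₂ : ℕ} (G : StepTwoCarnot d₁ d₂)

/-! ### The shift in terms of integrals against the derivative of `h` -/

/-- The first component of a path. -/
def horPart (ω : G.PathSpace) : C(I, EuclideanSpace ℝ (Fin d₁)) :=
  (ContinuousMap.fst : C(CarnotSpace d₁ d₂, _)).comp ω.1

/-- The second component of a path. -/
def verPart (ω : G.PathSpace) : C(I, EuclideanSpace ℝ (Fin d₂)) :=
  (ContinuousMap.snd : C(CarnotSpace d₁ d₂, _)).comp ω.1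

@[simp] theorem horPart_apply (ω : G.PathSpace) (t : I) : G.horPart ω t = (ω.1 t).1 := rfl

@[simp] theorem verPart_apply (ω : G.PathSpace) (t : I) : G.verPart ω t = (ω.1 t).2 := rfl

theorem continuous_horPart : Continuous G.horPart :=
  (ContinuousMap.continuous_postcomp _).comp continuous_subtype_val

theorem intervalIntegrable_bracket_deriv (y : C(I, EuclideanSpace ℝ (Fin d₁))) (h : ACPath d₁) :
    IntervalIntegrable (fun s => G.bracketCLM (pathExt y s) (deriv (pathExt h.1) s))
      volume 0 1 := by
  have hh := ACPath.intervalIntegrable_deriv h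
  have hy := continuous_pathExt y
  rw [intervalIntegrable_iff] at hh ⊢
  refine (hh.norm.const_mul (‖G.bracketCLM‖ * ‖y‖)).mono ?_ (Eventually.of_forall fun s => ?_)
  · exact (G.bracketCLM.aestronglyMeasurable_comp₂ hy.aestronglyMeasurable
      hh.aestronglyMeasurable)
  · refine (G.bracketCLM.le_opNorm₂ _ _).trans (le_trans ?_ (le_abs_self _))
    have : ‖pathExt y s‖ ≤ ‖y‖ := y.norm_coe_le_norm _
    gcongr

/-- The path `t ↦ ∫₀ᵗ [y, dh]`. -/
def bracketPrimitive (h : ACPath d₁) (y : C(I, EuclideanSpace ℝ (Fin d₁))) :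
    C(I, EuclideanSpace ℝ (Fin d₂)) :=
  ⟨fun t => ∫ s in (0 : ℝ)..t, G.bracketCLM (pathExt y s) (deriv (pathExt h.1) s), by
    have := intervalIntegral.continuousOn_primitive_interval (μ := volume) (a := 0) (b := 1)
      (f := fun s => G.bracketCLM (pathExt y s) (deriv (pathExt h.1) s))
      (by
        rw [Set.uIcc_of_le zero_le_one, integrableOn_Icc_iff_integrableOn_Ioc,
          ← intervalIntegrable_iff_integrableOn_Ioc_of_le zero_le_one]
        exact G.intervalIntegrable_bracket_deriv y h)
    rw [Set.uIcc_of_le zero_le_one] at this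
    exact continuousOn_iff_continuous_domRestrict.1 this⟩

theorem bracketPrimitive_apply (h : ACPath d₁) (y : C(I, EuclideanSpace ℝ (Fin d₁))) (t : I) :
    G.bracketPrimitive h y t =
      ∫ s in (0 : ℝ)..t, G.bracketCLM (pathExt y s) (deriv (pathExt h.1) s) := rfl

theorem intervalIntegrable_mono_unitInterval {E : Type*} [NormedAddCommGroup E] {f : ℝ → E}
    (hf : IntervalIntegrable f volume 0 1) (t : I) : IntervalIntegrable f volume 0 t :=
  hf.mono_set (by
    rw [Set.uIcc_of_le (zero_le_one' ℝ)]
    exact Set.uIcc_subset_Icc ⟨le_rfl, zero_le_one⟩ t.2)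

theorem continuous_bracketPrimitive (h : ACPath d₁) : Continuous (G.bracketPrimitive h) := by
  set K := ‖G.bracketCLM‖ * ∫ s in (0 : ℝ)..1, ‖deriv (pathExt h.1) s‖ with hK
  have hK0 : 0 ≤ K := mul_nonneg G.bracketCLM.opNorm_nonneg
    (intervalIntegral.integral_nonneg zero_le_one fun _ _ => norm_nonneg _)
  refine LipschitzWith.continuous (K := ⟨K, hK0⟩) (LipschitzWith.of_dist_le_mul fun y z => ?_)
  refine (ContinuousMap.dist_le (by positivity)).2 fun t => ?_
  rw [dist_eq_norm, bracketPrimitive_apply, bracketPrimitive_apply,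
    ← intervalIntegral.integral_sub
      (intervalIntegrable_mono_unitInterval (G.intervalIntegrable_bracket_deriv y h) t)
      (intervalIntegrable_mono_unitInterval (G.intervalIntegrable_bracket_deriv z h) t)]
  have hi := (ACPath.intervalIntegrable_deriv h).norm
  have hb : ∀ s ∈ Set.Ioc (0 : ℝ) t, ‖G.bracketCLM (pathExt y s) (deriv (pathExt h.1) s) -
      G.bracketCLM (pathExt z s) (deriv (pathExt h.1) s)‖ ≤
        ‖G.bracketCLM‖ * dist y z * ‖deriv (pathExt h.1) s‖ := by
    intro s _
    have he : G.bracketCLM (pathExt y s) (deriv (pathExt h.1) s) -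
      G.bracketCLM (pathExt z s) (deriv (pathExt h.1) s) =
        G.bracketCLM (pathExt y s - pathExt z s) (deriv (pathExt h.1) s) := by simp
    rw [he]
    refine (G.bracketCLM.le_opNorm₂ _ _).trans ?_
    have : ‖pathExt y s - pathExt z s‖ ≤ dist y z := by
      rw [← dist_eq_norm]
      exact ContinuousMap.dist_apply_le_dist _
    gcongr
  refine (intervalIntegral.norm_integral_le_of_norm_le t.2.1 (Eventually.of_forall hb)
    ((intervalIntegrable_mono_unitInterval hi t).const_mul _)).trans ?_
  rw [intervalIntegral.integral_const_mul]
  have hm : ∫ s in (0 : ℝ)..t, ‖deriv (pathExt h.1) s‖ ≤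
      ∫ s in (0 : ℝ)..1, ‖deriv (pathExt h.1) s‖ :=
    intervalIntegral.integral_mono_interval le_rfl t.2.1 t.2.2
      (Eventually.of_forall fun _ => norm_nonneg _) hi
  change _ ≤ K * dist y z
  calc _ ≤ ‖G.bracketCLM‖ * dist y z * ∫ s in (0 : ℝ)..1, ‖deriv (pathExt h.1) s‖ := by gcongr
    _ = _ := by rw [hK]; ring

@[simp]
theorem lift_fst (x : ACPath d₁) (t : I) : ((G.lift x).1 t).1 = x.1 t := rfl

theorem lift_snd (x : ACPath d₁) (t : I) :
    ((G.lift x).1 t).2 = (1 / 2 : ℝ) • G.bracketPrimitive x x.1 t := by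
  change (1 / 2 : ℝ) • _ = _
  congr 1
  have hi (i j : Fin d₁) : IntervalIntegrable
      (fun s => (pathExt x.1 s i * deriv (pathExt x.1) s j) • G.w i j) volume 0 t := by
    have h := intervalIntegrable_mono_unitInterval (ACPath.intervalIntegrable x i j) t
    exact ⟨Integrable.smul_const h.1 _, Integrable.smul_const h.2 _⟩
  simp only [bracketPrimitive_apply, bracketCLM_apply, bracket]
  rw [intervalIntegral.integral_finsetSum]
  · refine Finset.sum_congr rfl fun i _ => ?_
    rw [intervalIntegral.integral_finsetSum fun j _ => hi i j]
    exact Finset.sum_congr rfl fun j _ => (intervalIntegral.integral_smul_const _ _).symm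
  · intro i _
    simpa only [Finset.sum_fn] using IntervalIntegrable.sum Finset.univ fun j _ => hi i j

/-- Integration by parts for the bracket. -/
theorem bracketPrimitive_swap (x h : ACPath d₁) (t : I) :
    G.bracketPrimitive x h.1 t = G.bracketCLM (h.1 t) (x.1 t) + G.bracketPrimitive h x.1 t := by
  have hsub : Set.uIcc (0 : ℝ) t ⊆ Set.uIcc 0 1 := by
    rw [Set.uIcc_of_le (zero_le_one' ℝ)]
    exact Set.uIcc_subset_Icc ⟨le_rfl, zero_le_one⟩ t.2
  have hx := x.2.2.mono hsub
  have hh := h.2.2.mono hsub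
  have hBac := AbsolutelyContinuousOnInterval.bilin G.bracketCLM hh hx
  have hB := hBac.integral_deriv_eq_sub_euclidean
  have h0 : pathExt h.1 0 = 0 := (pathExt_apply h.1 0).trans h.2.1
  rw [pathExt_apply, pathExt_apply, h0] at hB
  simp only [map_zero, zero_apply, sub_zero] at hB
  rw [← hB, bracketPrimitive_apply, bracketPrimitive_apply, ← intervalIntegral.integral_add]
  · refine intervalIntegral.integral_congr_ae ?_
    filter_upwards [hx.ae_differentiableAt_euclidean, hh.ae_differentiableAt_euclidean]
      with s h1 h2 hs
    have hs' := Set.uIoc_subset_uIcc hs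
    have D := ((G.bracketCLM.hasFDerivAt.comp_hasDerivAt s (h2 hs').hasDerivAt).clm_apply
      (h1 hs').hasDerivAt).deriv
    simp only [Function.comp_def] at D
    rw [D, G.bracketCLM_skew (pathExt x.1 s)]
    abel
  · exact hBac.intervalIntegrable_deriv_euclidean
  · exact intervalIntegrable_mono_unitInterval (G.intervalIntegrable_bracket_deriv x.1 h) t

theorem bracketPrimitive_add_left (x h : ACPath d₁) (y : C(I, EuclideanSpace ℝ (Fin d₁)))
    (t : I) : G.bracketPrimitive (x + h) y t =
      G.bracketPrimitive x y t + G.bracketPrimitive h y t := by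
  simp only [bracketPrimitive_apply]
  rw [← intervalIntegral.integral_add
    (intervalIntegrable_mono_unitInterval (G.intervalIntegrable_bracket_deriv y x) t)
    (intervalIntegrable_mono_unitInterval (G.intervalIntegrable_bracket_deriv y h) t)]
  refine intervalIntegral.integral_congr_ae ?_
  filter_upwards [x.2.2.ae_differentiableAt_euclidean, h.2.2.ae_differentiableAt_euclidean]
    with s h1 h2 hs
  have hs' : s ∈ Set.uIcc (0 : ℝ) 1 := by
    rw [Set.uIcc_of_le (zero_le_one' ℝ)]
    rw [Set.uIoc_of_le t.2.1] at hs
    exact ⟨hs.1.le, hs.2.trans t.2.2⟩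
  have D : deriv (pathExt (x + h).1) s = _ := ((h1 hs').hasDerivAt.add (h2 hs').hasDerivAt).deriv
  rw [D, map_add]

theorem bracketPrimitive_add_right (h : ACPath d₁) (y z : C(I, EuclideanSpace ℝ (Fin d₁)))
    (t : I) : G.bracketPrimitive h (y + z) t =
      G.bracketPrimitive h y t + G.bracketPrimitive h z t := by
  simp only [bracketPrimitive_apply]
  rw [← intervalIntegral.integral_add
    (intervalIntegrable_mono_unitInterval (G.intervalIntegrable_bracket_deriv y h) t)
    (intervalIntegrable_mono_unitInterval (G.intervalIntegrable_bracket_deriv z h) t)]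
  simp only [pathExt_add, map_add, add_apply]

/-- The path `t ↦ [h_t, y_t]`. -/
def bracketPath (h y : C(I, EuclideanSpace ℝ (Fin d₁))) : C(I, EuclideanSpace ℝ (Fin d₂)) :=
  ⟨fun t => G.bracketCLM (h t) (y t), by fun_prop⟩

theorem continuous_bracketPath (h : C(I, EuclideanSpace ℝ (Fin d₁))) :
    Continuous (G.bracketPath h) := by
  refine ContinuousMap.continuous_of_continuous_uncurry _ ?_
  have h1 : Continuous fun p : C(I, EuclideanSpace ℝ (Fin d₁)) × I => p.1 p.2 := by fun_prop
  have h2 : Continuous fun p : C(I, EuclideanSpace ℝ (Fin d₁)) × I => h p.2 := by fun_prop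
  exact (G.bracketCLM.continuous.comp h2).clm_apply h1

/-- The path with components `y - y_0` and `z - z_0`. -/
def mkPath (y : C(I, EuclideanSpace ℝ (Fin d₁))) (z : C(I, EuclideanSpace ℝ (Fin d₂))) :
    G.PathSpace :=
  ⟨⟨fun t => (y t - y 0, z t - z 0), by fun_prop⟩, by simp⟩

theorem continuous_mkPath : Continuous fun p : C(I, EuclideanSpace ℝ (Fin d₁)) ×
    C(I, EuclideanSpace ℝ (Fin d₂)) => G.mkPath p.1 p.2 := by
  refine Continuous.subtype_mk (ContinuousMap.continuous_of_continuous_uncurry _ ?_) _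
  change Continuous fun q : (C(I, EuclideanSpace ℝ (Fin d₁)) ×
    C(I, EuclideanSpace ℝ (Fin d₂))) × I => (q.1.1 q.2 - q.1.1 0, q.1.2 q.2 - q.1.2 0)
  fun_prop

theorem continuous_verPart : Continuous G.verPart :=
  (ContinuousMap.continuous_postcomp _).comp continuous_subtype_val

variable {G} in
theorem pathSpace_ext {ω η : G.PathSpace} (h1 : ∀ t, (ω.1 t).1 = (η.1 t).1)
    (h2 : ∀ t, (ω.1 t).2 = (η.1 t).2) : ω = η :=
  Subtype.ext (ContinuousMap.ext fun t => Prod.ext (h1 t) (h2 t))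

/-- The shift by `h` written without a limit: after an integration by parts, only `h` is
differentiated. -/
def shiftMap (h : ACPath d₁) (ω : G.PathSpace) : G.PathSpace :=
  G.mkPath (G.horPart ω + h.1) (G.verPart ω + G.verPart (G.lift h) +
    ((1 / 2 : ℝ) • G.bracketPath h.1 (G.horPart ω) + G.bracketPrimitive h (G.horPart ω)))

theorem continuous_shiftMap (h : ACPath d₁) : Continuous (G.shiftMap h) := by
  have h1 := G.continuous_horPart
  have h2 := G.continuous_verPart
  have h3 := (G.continuous_bracketPath h.1).comp h1
  have h4 := (G.continuous_bracketPrimitive h).comp h1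
  exact G.continuous_mkPath.comp ((h1.add continuous_const).prodMk
    ((h2.add continuous_const).add ((h3.const_smul (1 / 2 : ℝ)).add h4)))

@[simp]
theorem bracketPrimitive_zero_time (h : ACPath d₁) (y : C(I, EuclideanSpace ℝ (Fin d₁))) :
    G.bracketPrimitive h y 0 = 0 := by
  simp [bracketPrimitive_apply]

theorem shiftMap_fst (h : ACPath d₁) (ω : G.PathSpace) (t : I) :
    ((G.shiftMap h ω).1 t).1 = (ω.1 t).1 + h.1 t := by
  have h0 : h.1 0 = 0 := h.2.1
  simp [shiftMap, mkPath, ω.2, h0]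

theorem shiftMap_snd (h : ACPath d₁) (ω : G.PathSpace) (t : I) :
    ((G.shiftMap h ω).1 t).2 = (ω.1 t).2 + ((G.lift h).1 t).2 +
      ((1 / 2 : ℝ) • G.bracketCLM (h.1 t) (ω.1 t).1 +
        G.bracketPrimitive h (G.horPart ω) t) := by
  have h0 : h.1 0 = 0 := h.2.1
  simp [shiftMap, mkPath, ω.2, h0, bracketPath, (G.lift h).2]

theorem shiftMap_lift (h x : ACPath d₁) : G.shiftMap h (G.lift x) = G.lift (x + h) := by
  refine pathSpace_ext (fun t => ?_) fun t => ?_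
  · rw [shiftMap_fst]
    rfl
  · have hx : G.horPart (G.lift x) = x.1 := rfl
    rw [shiftMap_snd, lift_snd, lift_snd, lift_snd, hx, bracketPrimitive_add_left]
    change _ = (1 / 2 : ℝ) • (G.bracketPrimitive x (x.1 + h.1) t +
      G.bracketPrimitive h (x.1 + h.1) t)
    rw [bracketPrimitive_add_right, bracketPrimitive_add_right, G.bracketPrimitive_swap x h,
      lift_fst]
    module

end StepTwoCarnot

/-! ### Density of the canonical lifts -/

/-- The path `t ↦ f_t v`. -/
def smulPath {d : ℕ} (f : C(I, ℝ)) (v : EuclideanSpace ℝ (Fin d)) :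
    C(I, EuclideanSpace ℝ (Fin d)) :=
  ⟨fun t => f t • v, by fun_prop⟩

theorem continuous_smulPath {d : ℕ} (v : EuclideanSpace ℝ (Fin d)) :
    Continuous fun f : C(I, ℝ) => smulPath f v := by
  refine ContinuousMap.continuous_of_continuous_uncurry _ ?_
  have h1 : Continuous fun p : C(I, ℝ) × I => p.1 p.2 := by fun_prop
  exact h1.smul continuous_const

theorem sum_smulPath {d : ℕ} (y : C(I, EuclideanSpace ℝ (Fin d))) :
    ∑ i, smulPath ⟨fun t => y t i, by fun_prop⟩ (EuclideanSpace.single i 1) = y := by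
  refine ContinuousMap.ext fun t => ?_
  rw [ContinuousMap.coe_sum, Finset.sum_apply]
  simpa using! (EuclideanSpace.basisFun (Fin d) ℝ).sum_repr (y t)

/-- The closed set of the continuous maps with a property is everything as soon as it contains the
polynomials. -/
theorem mem_of_polynomial_mem {S : Set C(I, ℝ)} (hS : IsClosed S)
    (hp : ∀ p : Polynomial ℝ, p.toContinuousMapOn (Set.Icc 0 1) ∈ S) (f : C(I, ℝ)) : f ∈ S := by
  have h : f ∈ (polynomialFunctions (Set.Icc (0 : ℝ) 1)).topologicalClosure :=
    continuousMap_mem_polynomialFunctions_closure 0 1 f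
  refine closure_minimal ?_ hS h
  intro g hg
  obtain ⟨p, rfl⟩ : ∃ p : Polynomial ℝ, p.toContinuousMapOn (Set.Icc 0 1) = g := by
    simpa [polynomialFunctions] using hg
  exact hp p

theorem contDiff_eval_polynomial (p : Polynomial ℝ) : ContDiff ℝ 1 fun t : ℝ => p.eval t := by
  simpa [Polynomial.coe_aeval_eq_eval] using p.contDiff_aeval (𝕜 := ℝ) 1

/-- Continuous paths from the origin are uniform limits of absolutely continuous ones. -/
theorem ACPath.mem_closure {d : ℕ} (y : C(I, EuclideanSpace ℝ (Fin d))) (hy : y 0 = 0) :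
    y ∈ closure (ACPath d : Set C(I, EuclideanSpace ℝ (Fin d))) := by
  change y ∈ (ACPath d).topologicalClosure
  have key (v : EuclideanSpace ℝ (Fin d)) (f : C(I, ℝ)) :
      smulPath (f - .const I (f 0)) v ∈ (ACPath d).topologicalClosure := by
    have hc : Continuous fun f : C(I, ℝ) => smulPath (f - .const I (f 0)) v := by
      refine (continuous_smulPath v).comp (continuous_id.sub ?_)
      exact ContinuousMap.continuous_const'.comp (continuous_eval_const 0)
    refine mem_of_polynomial_mem
      (S := (fun f : C(I, ℝ) => smulPath (f - .const I (f 0)) v) ⁻¹' (ACPath d).topologicalClosure)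
      ((ACPath d).isClosed_topologicalClosure.preimage hc) (fun p => ?_) f
    refine (ACPath d).le_topologicalClosure ?_
    have hX : ContDiff ℝ 1 fun t : ℝ => (p.eval t - p.eval 0) • v :=
      ((contDiff_eval_polynomial p).sub contDiff_const).smul contDiff_const
    have hm := (ACPath.ofContDiff _ hX (by simp)).2
    exact hm
  rw [← sum_smulPath y]
  refine sum_mem fun i _ => ?_
  convert key (EuclideanSpace.single i 1) ⟨fun t => y t i, by fun_prop⟩ using 2
  ext t
  simp [hy]

namespace StepTwoCarnot

variable {d₁ d₂ : ℕ} (G : StepTwoCarnot d₁ d₂)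

theorem lift_snd_ofContDiff {X : ℝ → EuclideanSpace ℝ (Fin d₁)} (hX : ContDiff ℝ 1 X)
    (h0 : X 0 = 0) {Z : ℝ → EuclideanSpace ℝ (Fin d₂)} (hZ0 : Z 0 = 0)
    (hZ : ∀ t, HasDerivAt Z ((1 / 2 : ℝ) • G.bracketCLM (X t) (deriv X t)) t) (t : I) :
    ((G.lift (ACPath.ofContDiff X hX h0)).1 t).2 = Z t := by
  have hc : Continuous fun t => G.bracketCLM (X t) (deriv X t) :=
    (G.bracketCLM.continuous.comp hX.continuous).clm_apply (hX.continuous_deriv le_rfl)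
  have hF : ∫ s in (0 : ℝ)..t, (1 / 2 : ℝ) • G.bracketCLM (X s) (deriv X s) = Z t - Z 0 :=
    intervalIntegral.integral_eq_sub_of_hasDerivAt (fun s _ => hZ s)
      ((hc.const_smul (1 / 2 : ℝ)).intervalIntegrable _ _)
  rw [hZ0, sub_zero, intervalIntegral.integral_smul] at hF
  rw [lift_snd, bracketPrimitive_apply, ← hF]
  congr 1
  refine intervalIntegral.integral_congr_ae ?_
  filter_upwards [ACPath.ae_deriv_pathExt_ofContDiff hX h0 t] with s hs hm
  rw [hs hm]
  rw [Set.uIoc_of_le t.2.1] at hm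
  rw [ACPath.pathExt_ofContDiff hX h0 ⟨hm.1.le, hm.2.trans t.2.2⟩]

theorem mkPath_fst (y : C(I, EuclideanSpace ℝ (Fin d₁))) (z : C(I, EuclideanSpace ℝ (Fin d₂)))
    (t : I) : ((G.mkPath y z).1 t).1 = y t - y 0 := rfl

theorem mkPath_snd (y : C(I, EuclideanSpace ℝ (Fin d₁))) (z : C(I, EuclideanSpace ℝ (Fin d₂)))
    (t : I) : ((G.mkPath y z).1 t).2 = z t - z 0 := rfl

/-- A rapid rotation in the plane of `V_i, V_j`, of radius `1/N` and angle `2 N² (p - p_0)`, moves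
the second component along `(p - p_0) w_{ij}`, up to an error of order `N⁻²`. -/
theorem vertical_polynomial_mem_closure (i j : Fin d₁) (p : Polynomial ℝ) :
    G.mkPath 0 (smulPath (p.toContinuousMapOn (Set.Icc 0 1)) (G.w i j)) ∈
      closure (Set.range G.lift) := by
  -- The factor `2` makes up for the `½` in the area.
  set θ : ℝ → ℝ := fun t => 2 * (p.eval t - p.eval 0) with hθ
  have hθc : ContDiff ℝ 1 θ := contDiff_const.mul ((contDiff_eval_polynomial p).sub contDiff_const)
  have hθ0 : θ 0 = 0 := by simp [hθ]
  set e := EuclideanSpace.single i (1 : ℝ) with he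
  set f := EuclideanSpace.single j (1 : ℝ) with hf
  set X : ℝ → ℝ → EuclideanSpace ℝ (Fin d₁) := fun N t =>
    (N⁻¹ * Real.sin (N ^ 2 * θ t)) • e + (N⁻¹ * (1 - Real.cos (N ^ 2 * θ t))) • f with hX
  have hXc (N : ℝ) : ContDiff ℝ 1 (X N) := by
    have h1 : ContDiff ℝ 1 fun t => N ^ 2 * θ t := contDiff_const.mul hθc
    exact ((contDiff_const.mul (Real.contDiff_sin.comp h1)).smul contDiff_const).add
      ((contDiff_const.mul (contDiff_const.sub (Real.contDiff_cos.comp h1))).smul contDiff_const)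
  have hX0 (N : ℝ) : X N 0 = 0 := by simp [hX, hθ0]
  set Z : ℝ → ℝ → EuclideanSpace ℝ (Fin d₂) := fun N t =>
    ((1 / 2 : ℝ) * (θ t - (N ^ 2)⁻¹ * Real.sin (N ^ 2 * θ t))) • G.w i j with hZ
  have hZ0 (N : ℝ) : Z N 0 = 0 := by simp [hZ, hθ0]
  have hw : G.bracketCLM e f = G.w i j := by simp [he, hf, G.bracketCLM_single]
  have hw' : G.bracketCLM f e = -G.w i j := by rw [G.bracketCLM_skew, hw]
  have hZd (N : ℝ) (hN : 0 < N) (t : ℝ) :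
      HasDerivAt (Z N) ((1 / 2 : ℝ) • G.bracketCLM (X N t) (deriv (X N) t)) t := by
    have dθ : HasDerivAt θ (deriv θ t) t := (hθc.differentiable one_ne_zero t).hasDerivAt
    have dN := dθ.const_mul (N ^ 2)
    have dX := ((dN.sin.const_mul N⁻¹).smul_const e).add
      (((dN.cos.const_sub 1).const_mul N⁻¹).smul_const f)
    have dX' : deriv (X N) t = _ := dX.deriv
    have dZ := ((dθ.sub (dN.sin.const_mul (N ^ 2)⁻¹)).const_mul (1 / 2 : ℝ)).smul_const (G.w i j)
    refine dZ.congr_deriv ?_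
    rw [dX']
    simp only [hX, map_add, map_smul, add_apply, smul_apply, hw, hw', bracketCLM_self, smul_zero,
      zero_add, add_zero, smul_neg, smul_smul, ← neg_smul, ← add_smul]
    congr 1
    have hcs := Real.sin_sq_add_cos_sq (N ^ 2 * θ t)
    field_simp
    linear_combination (-deriv θ t) * hcs
  have hmem (n : ℕ) : G.lift (ACPath.ofContDiff (X (n + 1)) (hXc _) (hX0 _)) ∈
      Set.range G.lift := ⟨_, rfl⟩
  refine mem_closure_of_tendsto (b := atTop) ?_ (Eventually.of_forall hmem)
  refine tendsto_subtype_rng.2 (tendsto_iff_dist_tendsto_zero.2 ?_)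
  have hlim : Tendsto (fun n : ℕ => (3 + ‖G.w i j‖) * (1 / ((n : ℝ) + 1))) atTop (𝓝 0) := by
    simpa using tendsto_one_div_add_atTop_nhds_zero_nat.const_mul (3 + ‖G.w i j‖)
  refine squeeze_zero (fun _ => dist_nonneg) (fun n => ?_) hlim
  have hn : (0 : ℝ) < n + 1 := by positivity
  have hn1 : ((n : ℝ) + 1)⁻¹ ≤ 1 := inv_le_one_of_one_le₀ (by linarith [n.cast_nonneg (α := ℝ)])
  refine (ContinuousMap.dist_le (by positivity)).2 fun t => ?_
  rw [Prod.dist_eq, lift_fst, G.lift_snd_ofContDiff (hXc _) (hX0 _) (hZ0 _) (hZd _ hn), mkPath_fst,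
    mkPath_snd, ACPath.ofContDiff_apply, one_div]
  refine max_le ?_ ?_
  · rw [dist_eq_norm]
    simp only [ContinuousMap.zero_apply, sub_zero]
    have h1 : ‖e‖ = 1 := by simp [he]
    have h2 : ‖f‖ = 1 := by simp [hf]
    refine (norm_add_le _ _).trans ?_
    rw [norm_smul, norm_smul, h1, h2, norm_mul, norm_mul, Real.norm_eq_abs, Real.norm_eq_abs,
      Real.norm_eq_abs, abs_of_pos (inv_pos.2 hn)]
    have h3 := Real.abs_sin_le_one (((n : ℝ) + 1) ^ 2 * θ t)
    have h4 : |1 - Real.cos (((n : ℝ) + 1) ^ 2 * θ t)| ≤ 2 := by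
      rw [abs_le]
      constructor <;> linarith [Real.cos_le_one (((n : ℝ) + 1) ^ 2 * θ t),
        Real.neg_one_le_cos (((n : ℝ) + 1) ^ 2 * θ t)]
    have hp := inv_pos.2 hn
    nlinarith [norm_nonneg (G.w i j), mul_le_mul_of_nonneg_left h3 hp.le,
      mul_le_mul_of_nonneg_left h4 hp.le, mul_nonneg hp.le (norm_nonneg (G.w i j))]
  · have hs : Z (n + 1) t - (smulPath (p.toContinuousMapOn (Set.Icc 0 1)) (G.w i j) t -
        smulPath (p.toContinuousMapOn (Set.Icc 0 1)) (G.w i j) 0) =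
        (-(1 / 2 * ((((n : ℝ) + 1) ^ 2)⁻¹ * Real.sin (((n : ℝ) + 1) ^ 2 * θ t)))) • G.w i j := by
      change _ - (p.eval (t : ℝ) • G.w i j - p.eval (0 : ℝ) • G.w i j) = _
      simp only [hZ, hθ]
      module
    rw [dist_eq_norm, hs, norm_smul, norm_neg, norm_mul, norm_mul, Real.norm_eq_abs,
      Real.norm_eq_abs, Real.norm_eq_abs]
    have h3 := Real.abs_sin_le_one (((n : ℝ) + 1) ^ 2 * θ t)
    have h5 : |(((n : ℝ) + 1) ^ 2)⁻¹| ≤ ((n : ℝ) + 1)⁻¹ := by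
      rw [abs_of_pos (by positivity), ← inv_pow, sq]
      exact mul_le_of_le_one_left (by positivity) hn1
    have h6 : |(1 / 2 : ℝ)| ≤ 1 := by norm_num [abs_of_pos]
    calc _ ≤ 1 * (((n : ℝ) + 1)⁻¹ * 1) * ‖G.w i j‖ := by gcongr
      _ ≤ _ := by
        have hp := inv_pos.2 hn
        nlinarith

/-- Translation of a path by a path in the centre. -/
def addVertical (e : C(I, EuclideanSpace ℝ (Fin d₂))) (ω : G.PathSpace) : G.PathSpace :=
  G.mkPath (G.horPart ω) (G.verPart ω + e)

theorem continuous_addVertical (e : C(I, EuclideanSpace ℝ (Fin d₂))) :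
    Continuous (G.addVertical e) :=
  G.continuous_mkPath.comp
    (G.continuous_horPart.prodMk (G.continuous_verPart.add continuous_const))

/-- Vertical translations commute with shifts and the shifts preserve the set of lifts, so that the
closure of the set of lifts is invariant under `e` as soon as it contains `(0, e)`. -/
theorem addVertical_mem_closure {e : C(I, EuclideanSpace ℝ (Fin d₂))}
    (he : G.mkPath 0 e ∈ closure (Set.range G.lift)) {ω : G.PathSpace}
    (hω : ω ∈ closure (Set.range G.lift)) :
    G.addVertical e ω ∈ closure (Set.range G.lift) := by
  rw [← closure_closure]
  refine map_mem_closure (G.continuous_addVertical e) hω ?_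
  rintro _ ⟨x, rfl⟩
  have h : G.addVertical e (G.lift x) = G.shiftMap x (G.mkPath 0 e) := by
    have h0 : G.horPart (G.mkPath 0 e) = 0 := by
      ext t : 1
      simp [mkPath_fst]
    refine pathSpace_ext (fun t => ?_) fun t => ?_
    · rw [shiftMap_fst]
      simp [addVertical, mkPath_fst, (G.lift x).2]
    · rw [shiftMap_snd, h0]
      simp [addVertical, mkPath_snd, (G.lift x).2, mkPath_fst, bracketPrimitive_apply, pathExt,
        Set.IccExtend]
      abel
  rw [h]
  refine map_mem_closure (G.continuous_shiftMap x) he ?_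
  rintro _ ⟨y, rfl⟩
  exact ⟨_, (G.shiftMap_lift x y).symm⟩

theorem vertical_mem_closure (e : C(I, EuclideanSpace ℝ (Fin d₂))) :
    G.mkPath 0 e ∈ closure (Set.range G.lift) := by
  have hadd {e e' : C(I, EuclideanSpace ℝ (Fin d₂))}
      (he : G.mkPath 0 e ∈ closure (Set.range G.lift))
      (he' : G.mkPath 0 e' ∈ closure (Set.range G.lift)) :
      G.mkPath 0 (e + e') ∈ closure (Set.range G.lift) := by
    convert G.addVertical_mem_closure he' he using 1
    refine pathSpace_ext (fun t => ?_) fun t => ?_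
    · simp [addVertical, mkPath_fst]
    · simp [addVertical, mkPath_snd]
      abel
  have hzero : G.mkPath 0 0 ∈ closure (Set.range G.lift) := by
    refine subset_closure ⟨0, pathSpace_ext (fun t => ?_) fun t => ?_⟩
    · simp [mkPath_fst]
    · rw [lift_snd]
      simp [mkPath_snd, bracketPrimitive_apply, pathExt, Set.IccExtend]
  have hsmul (v : EuclideanSpace ℝ (Fin d₂)) (f : C(I, ℝ)) :
      G.mkPath 0 (smulPath f v) ∈ closure (Set.range G.lift) := by
    have hv : v ∈ Submodule.span ℝ (Set.range fun p : Fin d₁ × Fin d₁ => G.w p.1 p.2) :=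
      G.span_eq_top ▸ Submodule.mem_top
    induction hv using Submodule.span_induction generalizing f with
    | mem v hv =>
      obtain ⟨⟨i, j⟩, rfl⟩ := hv
      refine mem_of_polynomial_mem
        (S := (fun f : C(I, ℝ) => G.mkPath 0 (smulPath f (G.w i j))) ⁻¹'
          closure (Set.range G.lift)) (isClosed_closure.preimage ?_)
        (fun p => G.vertical_polynomial_mem_closure i j p) f
      exact G.continuous_mkPath.comp (continuous_const.prodMk (continuous_smulPath _))
    | zero =>
      convert hzero using 2
      ext t : 1
      simp [smulPath]
    | add x y _ _ hx hy =>
      convert hadd (hx f) (hy f) using 2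
      ext t : 1
      simp [smulPath]
    | smul r x _ hx =>
      convert hx (r • f) using 2
      ext t : 1
      simp [smulPath, smul_smul, mul_comm]
  rw [← sum_smulPath e]
  exact Finset.sum_induction _ (fun e => G.mkPath 0 e ∈ closure (Set.range G.lift))
    (fun _ _ => hadd) hzero fun i _ => hsmul _ _

theorem mem_closure_range_lift (ω : G.PathSpace) : ω ∈ closure (Set.range G.lift) := by
  have h0 : G.horPart ω 0 = 0 := by simp [ω.2]
  have hω : ω = G.mkPath (G.horPart ω) (G.verPart ω) :=
    pathSpace_ext (fun t => by simp [mkPath_fst, ω.2]) fun t => by simp [mkPath_snd, ω.2]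
  rw [hω, ← closure_closure]
  refine map_mem_closure (f := fun y => G.mkPath y (G.verPart ω))
    (G.continuous_mkPath.comp (continuous_id.prodMk continuous_const))
    (ACPath.mem_closure _ h0) ?_
  intro x hx
  have h : G.mkPath x (G.verPart ω) =
      G.addVertical (G.verPart ω - G.verPart (G.lift ⟨x, hx⟩)) (G.lift ⟨x, hx⟩) :=
    pathSpace_ext (fun t => by simp [addVertical, mkPath_fst])
      fun t => by simp [addVertical, mkPath_snd]
  refine Set.mem_of_eq_of_mem h ?_
  exact G.addVertical_mem_closure (G.vertical_mem_closure _) (subset_closure ⟨_, rfl⟩)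

theorem shift_eq (h : ACPath d₁) (ω : G.PathSpace) : G.shift h ω = G.shiftMap h ω := by
  have : NeBot (comap G.lift (𝓝 ω)) :=
    comap_neBot_iff_frequently.2 (mem_closure_iff_frequently.1 (G.mem_closure_range_lift ω))
  refine Tendsto.limUnder_eq ?_
  have h1 := ((G.continuous_shiftMap h).tendsto ω).comp
    (tendsto_comap : Tendsto G.lift (comap G.lift (𝓝 ω)) (𝓝 ω))
  exact h1.congr fun x => G.shiftMap_lift h x

/-- The `h` with `η = T_h ω` is determined by the first components. -/
theorem cost_shift {h : ACPath d₁} (hh : h ∈ cameronMartin d₁) (ω : G.PathSpace) :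
    G.cost ω (G.shift h ω) = ENNReal.ofReal (cameronMartinNorm h) := by
  refine le_antisymm (iInf₂_le h ⟨hh, rfl⟩) (le_iInf₂ fun h' hh' => ?_)
  have heq : h = h' := by
    refine Subtype.ext (ContinuousMap.ext fun t => ?_)
    have := congrArg (fun η : G.PathSpace => (η.1 t).1) hh'.2
    simpa [shift_eq, shiftMap_fst] using this
  rw [heq]

end StepTwoCarnot

/-! ### The discretised cost of a shift along a line -/

namespace StepTwoCarnot

variable {d₁ d₂ : ℕ} (G : StepTwoCarnot d₁ d₂)

theorem bracketPrimitive_linPath (v : EuclideanSpace ℝ (Fin d₁))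
    (y : C(I, EuclideanSpace ℝ (Fin d₁))) (t : I) :
    G.bracketPrimitive (linPath v) y t = -∫ r in (0 : ℝ)..t, G.bracketCLM v (pathExt y r) := by
  rw [bracketPrimitive_apply, ← intervalIntegral.integral_neg]
  refine intervalIntegral.integral_congr_ae ?_
  filter_upwards [ae_deriv_linPath v t] with r hr hm
  rw [hr hm, G.bracketCLM_skew]

theorem lift_linPath_snd (v : EuclideanSpace ℝ (Fin d₁)) (t : I) :
    ((G.lift (linPath v)).1 t).2 = 0 := by
  refine G.lift_snd_ofContDiff (X := fun s : ℝ => s • v) (contDiff_id.smul contDiff_const)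
    (zero_smul _ _) (Z := fun _ => 0) rfl (fun s => ?_) t
  rw [deriv_smul_const_id]
  simpa using hasDerivAt_const s (0 : EuclideanSpace ℝ (Fin d₂))

/-- The vertical discrepancy between the increments of `ω` and of its shift along `t ↦ t v`. -/
theorem vert_increment_shift (v : EuclideanSpace ℝ (Fin d₁)) (ω : G.PathSpace) (s t : I) :
    G.vert (G.increment ω s t) (G.increment (G.shift (linPath v) ω) s t) =
      ∫ r in (s : ℝ)..t, G.bracketCLM v (pathExt (G.horPart ω) t - pathExt (G.horPart ω) r) := by
  set y := G.horPart ω with hy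
  have hc : Continuous fun r => G.bracketCLM v (pathExt y r) :=
    (G.bracketCLM v).continuous.comp (continuous_pathExt y)
  have hint (a b : ℝ) : IntervalIntegrable (fun r => G.bracketCLM v (pathExt y r)) volume a b :=
    hc.intervalIntegrable a b
  have hst := intervalIntegral.integral_add_adjacent_intervals (hint 0 s) (hint s t)
  simp only [map_sub]
  rw [intervalIntegral.integral_sub (by simp) (hint _ _), intervalIntegral.integral_const,
    pathExt_apply]
  have e1 (r : I) : ((G.shift (linPath v) ω).1 r).1 = y r + (r : ℝ) • v := by
    rw [shift_eq, shiftMap_fst]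
    rfl
  have e2 (r : I) : ((G.shift (linPath v) ω).1 r).2 = (ω.1 r).2 +
      ((1 / 2 : ℝ) • (r : ℝ) • G.bracketCLM v (y r) -
        ∫ r' in (0 : ℝ)..r, G.bracketCLM v (pathExt y r')) := by
    rw [shift_eq, shiftMap_snd, lift_linPath_snd, bracketPrimitive_linPath, linPath_apply]
    simp [hy, sub_eq_add_neg]
  have e3 (r : I) : (ω.1 r).1 = y r := rfl
  simp only [vert, increment, inv, mul_eq, Prod.fst_neg, Prod.snd_neg, e1, e2, e3, map_add, map_neg,
    map_smul, add_apply, neg_apply, smul_apply, bracketCLM_self]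
  rw [← hst, G.bracketCLM_skew (y s) v, G.bracketCLM_skew (y t) v, G.bracketCLM_skew (y t) (y s)]
  module

theorem sum_norm_vert_le_discCost (n : ℕ) (ω η : G.PathSpace) :
    2 ^ n * ∑ k ∈ Finset.range (2 ^ n), ‖G.vert (G.increment ω (dyadic n k) (dyadic n (k + 1)))
      (G.increment η (dyadic n k) (dyadic n (k + 1)))‖ ≤
        ‖G.bracketCLM‖ / 2 * G.discCost n ω η ^ 2 := by
  rw [discCost, Real.sq_sqrt (by positivity), mul_left_comm, Finset.mul_sum (a := _ / 2)]
  gcongr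
  exact G.norm_vert_le _ _

theorem coe_dyadic {n k : ℕ} (hk : k ≤ 2 ^ n) : (dyadic n k : ℝ) = k / 2 ^ n := by
  have h : (k : ℝ) / 2 ^ n ∈ Set.Icc (0 : ℝ) 1 :=
    ⟨by positivity, div_le_one_of_le₀ (by exact_mod_cast hk) (by positivity)⟩
  rw [dyadic, Set.projIcc_of_mem _ h]

/-- Already on smooth paths the limit of the costs can differ from the Cameron-Martin cost: for
`ω_t = (c t e_j, 0)` and `h_t = t e_i` the discretised costs are at least `(c |w_{ij}| / K)^{1/2}`,
where `K` is the norm of the bracket, whereas `‖h‖ = 1`. -/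
theorem exists_not_tendsto_discCost : ∃ ω η : G.PathSpace,
    ¬ Tendsto (fun n => ENNReal.ofReal (G.discCost n ω η)) atTop (𝓝 (G.cost ω η)) := by
  obtain ⟨i, j, hw⟩ := G.exists_w_ne_zero
  have hw0 := norm_pos_iff.2 hw
  set K := ‖G.bracketCLM‖ with hK
  have hK0 : 0 < K := G.norm_bracketCLM_pos
  set e := EuclideanSpace.single i (1 : ℝ) with he
  set f := EuclideanSpace.single j (1 : ℝ) with hf
  set c : ℝ := 4 * K / ‖G.w i j‖ with hc
  have hc0 : 0 < c := by positivity
  refine ⟨G.lift (linPath (c • f)), G.shift (linPath e) (G.lift (linPath (c • f))), fun hlim => ?_⟩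
  rw [G.cost_shift (linPath_mem_cameronMartin e), cameronMartinNorm_linPath] at hlim
  have hge (n : ℕ) : 2 ≤ G.discCost n (G.lift (linPath (c • f)))
      (G.shift (linPath e) (G.lift (linPath (c • f)))) := by
    have hsum := G.sum_norm_vert_le_discCost n (G.lift (linPath (c • f)))
      (G.shift (linPath e) (G.lift (linPath (c • f))))
    have hterm : ∀ k ∈ Finset.range (2 ^ n),
        ‖G.vert (G.increment (G.lift (linPath (c • f))) (dyadic n k) (dyadic n (k + 1)))
          (G.increment (G.shift (linPath e) (G.lift (linPath (c • f)))) (dyadic n k)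
            (dyadic n (k + 1)))‖ = c / 2 * ‖G.w i j‖ * (1 / 2 ^ n) ^ 2 := by
      intro k hk
      have hk' := Finset.mem_range.1 hk
      have hs := coe_dyadic (n := n) hk'.le
      have ht := coe_dyadic (n := n) (k := k + 1) hk'
      set s := dyadic n k
      set t := dyadic n (k + 1)
      have hst : (t : ℝ) - s = 1 / 2 ^ n := by
        rw [hs, ht]
        push_cast
        ring
      have hst0 : (s : ℝ) ≤ t := by
        have : (0 : ℝ) ≤ 1 / 2 ^ n := by positivity
        linarith
      have hI : ∫ r in (s : ℝ)..t, G.bracketCLM e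
          (pathExt (G.horPart (G.lift (linPath (c • f)))) t -
          pathExt (G.horPart (G.lift (linPath (c • f)))) r) =
            ∫ r in (s : ℝ)..t, ((t : ℝ) - r) • c • G.w i j := by
        refine intervalIntegral.integral_congr fun r hr => ?_
        rw [Set.uIcc_of_le hst0] at hr
        have hr' : r ∈ Set.Icc (0 : ℝ) 1 := ⟨s.2.1.trans hr.1, hr.2.trans t.2.2⟩
        have h1 : pathExt (G.horPart (G.lift (linPath (c • f)))) r = r • c • f :=
          Set.IccExtend_of_mem _ _ hr'
        have h2 : pathExt (G.horPart (G.lift (linPath (c • f)))) t = (t : ℝ) • c • f :=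
          Set.IccExtend_of_mem _ _ t.2
        have h3 : G.bracketCLM e f = G.w i j := by simp [he, hf, G.bracketCLM_single]
        beta_reduce
        rw [h1, h2, map_sub, map_smul, map_smul, map_smul, h3, sub_smul, map_smul, h3]
      have hJ : ∫ r in (s : ℝ)..t, ((t : ℝ) - r) = (1 / 2 ^ n) ^ 2 / 2 := by
        rw [intervalIntegral.integral_sub (by simp) (by simp), intervalIntegral.integral_const,
          integral_id, smul_eq_mul, ← hst]
        ring
      rw [G.vert_increment_shift, hI, intervalIntegral.integral_smul_const, hJ, norm_smul,
        norm_smul, Real.norm_of_nonneg (by positivity), Real.norm_of_nonneg hc0.le]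
      ring
    rw [Finset.sum_congr rfl hterm, Finset.sum_const, Finset.card_range, nsmul_eq_mul] at hsum
    have hl : (2 : ℝ) ^ n * (((2 ^ n : ℕ) : ℝ) * (c / 2 * ‖G.w i j‖ * (1 / 2 ^ n) ^ 2)) =
        2 * K := by
      rw [hc]
      push_cast
      field_simp
      norm_num
    rw [hl] at hsum
    have h4 : 4 ≤ G.discCost n (G.lift (linPath (c • f)))
        (G.shift (linPath e) (G.lift (linPath (c • f)))) ^ 2 := by
      nlinarith
    have h0 : 0 ≤ G.discCost n (G.lift (linPath (c • f)))
        (G.shift (linPath e) (G.lift (linPath (c • f)))) := Real.sqrt_nonneg _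
    nlinarith
  have h2 : ENNReal.ofReal 2 ≤ ENNReal.ofReal ‖e‖ :=
    ge_of_tendsto' hlim fun n => ENNReal.ofReal_le_ofReal (hge n)
  have he1 : ‖e‖ = 1 := by simp [he]
  rw [he1, ENNReal.ofReal_le_ofReal_iff zero_le_one] at h2
  norm_num at h2

end StepTwoCarnot

/-! ### Riemann sums -/

theorem tendsto_riemann_sum {g : ℝ → ℝ} (hg : Continuous g) (s : ℝ) {δ : ℝ} (hδ : 0 < δ) :
    Tendsto (fun N : ℕ => δ / (N + 1) * ∑ q ∈ Finset.range (N + 1), g (s + δ * (q / (N + 1))))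
      atTop (𝓝 (∫ r in s..s + δ, g r)) := by
  have huc := isCompact_Icc.uniformContinuousOn_of_continuous
    (hg.continuousOn (s := Set.Icc s (s + δ)))
  rw [Metric.uniformContinuousOn_iff] at huc
  rw [Metric.tendsto_atTop]
  intro ε hε
  obtain ⟨η, hη, h⟩ := huc (ε / (2 * δ)) (by positivity)
  obtain ⟨N₀, hN₀⟩ := exists_nat_gt (δ / η)
  refine ⟨N₀, fun N hN => ?_⟩
  have hN1 : (0 : ℝ) < N + 1 := by positivity
  set x : ℕ → ℝ := fun q => s + δ * (q / (N + 1)) with hx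
  have hmono (q : ℕ) : x q ≤ x (q + 1) := by
    simp only [hx]
    push_cast
    gcongr
    linarith
  have hstep (q : ℕ) : x (q + 1) - x q = δ / (N + 1) := by
    simp only [hx]
    push_cast
    field_simp
    ring
  have hsmall : δ / (N + 1) < η := by
    rw [div_lt_iff₀ hN1]
    rw [div_lt_iff₀ hη] at hN₀
    have : (N₀ : ℝ) ≤ N := by exact_mod_cast hN
    nlinarith
  have hsum : ∫ r in s..s + δ, g r =
      ∑ q ∈ Finset.range (N + 1), ∫ r in x q..x (q + 1), g r := by
    rw [intervalIntegral.sum_integral_adjacent_intervals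
      (fun q _ => hg.intervalIntegrable _ _)]
    congr 1
    · simp [hx]
    · simp only [hx]
      push_cast
      field_simp
  have hmem {q : ℕ} (hq : q ≤ N + 1) : x q ∈ Set.Icc s (s + δ) := by
    have h1 : (q : ℝ) / (N + 1) ≤ 1 := by
      rw [div_le_one hN1]
      exact_mod_cast hq
    have h2 : (0 : ℝ) ≤ q / (N + 1) := by positivity
    constructor <;> simp only [hx] <;> nlinarith
  rw [hsum, Finset.mul_sum, dist_eq_norm, ← Finset.sum_sub_distrib]
  have hterm : ∀ q ∈ Finset.range (N + 1), ‖δ / (N + 1) * g (x q) -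
      ∫ r in x q..x (q + 1), g r‖ ≤ ε / (2 * δ) * (δ / (N + 1)) := by
    intro q hq
    have hq' := Finset.mem_range.1 hq
    have e : δ / (N + 1) * g (x q) - ∫ r in x q..x (q + 1), g r =
        ∫ r in x q..x (q + 1), (g (x q) - g r) := by
      rw [intervalIntegral.integral_sub (by simp) (hg.intervalIntegrable _ _),
        intervalIntegral.integral_const, hstep, smul_eq_mul]
    rw [e, ← hstep q, ← abs_of_nonneg (sub_nonneg.2 (hmono q))]
    refine intervalIntegral.norm_integral_le_of_norm_le_const fun r hr => ?_
    rw [Set.uIoc_of_le (hmono q)] at hr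
    have h1 := hmem hq'.le
    have h2 := hmem (q := q + 1) hq'
    refine (h _ h1 r ⟨h1.1.trans hr.1.le, hr.2.trans h2.2⟩ ?_).le
    rw [dist_comm, Real.dist_eq, abs_of_pos (sub_pos.2 hr.1)]
    linarith [hr.2, hstep q]
  refine (norm_sum_le_of_le _ hterm).trans_lt ?_
  rw [Finset.sum_const, Finset.card_range, nsmul_eq_mul]
  push_cast
  field_simp
  linarith

theorem Finset.sum_range_mul_block {M : Type*} [AddCommMonoid M] (f : ℕ → M) (m N : ℕ) :
    ∑ p ∈ Finset.range (m * N), f p =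
      ∑ k ∈ Finset.range m, ∑ q ∈ Finset.range N, f (k * N + q) := by
  induction m with
  | zero => simp
  | succ m ih => rw [Nat.succ_mul, Finset.sum_range_add, ih, Finset.sum_range_succ]

/-- Summation by parts: the sum of the distances to the end of the block. -/
theorem sum_range_weighted_increments (f : ℕ → ℝ) (N : ℕ) :
    ∑ q ∈ Finset.range N, ((q : ℝ) + 1) * (f (q + 1) - f q) =
      ∑ q ∈ Finset.range N, (f N - f q) := by
  induction N with
  | zero => simp
  | succ N ih =>
    have h : ∑ q ∈ Finset.range N, (f (N + 1) - f q) =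
        ∑ q ∈ Finset.range N, (f N - f q) + N * (f (N + 1) - f N) := by
      rw [← sub_eq_iff_eq_add', ← Finset.sum_sub_distrib]
      simp [mul_sub]
    rw [Finset.sum_range_succ, Finset.sum_range_succ, ih, h]
    ring

theorem sum_range_succ_sq (N : ℕ) :
    ∑ q ∈ Finset.range N, ((q : ℝ) + 1) ^ 2 = (N : ℝ) * (N + 1) * (2 * N + 1) / 6 := by
  induction N with
  | zero => simp
  | succ N ih =>
    rw [Finset.sum_range_succ, ih]
    push_cast
    ring

/-! ### Uncorrelated bounded variables -/

section Probability

variable {Ω : Type*} {mΩ : MeasurableSpace Ω} {P : Measure Ω}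

/-- The empirical mean of `m` pairwise uncorrelated variables with values in `[-1, 1]` and mean `ρ`
has variance at most `1 / m`. -/
theorem integral_sq_mean_sub_le [IsProbabilityMeasure P] {m : ℕ} (hm : 0 < m) (C : ℕ → Ω → ℝ)
    {ρ : ℝ} (hmeas : ∀ k, Measurable (C k)) (hb : ∀ k ω, |C k ω| ≤ 1)
    (h1 : ∀ k < m, ∫ ω, C k ω ∂P = ρ)
    (h2 : ∀ k < m, ∀ l < m, k ≠ l → ∫ ω, C k ω * C l ω ∂P = ρ ^ 2) :
    ∫ ω, ((m : ℝ)⁻¹ * ∑ k ∈ Finset.range m, C k ω - ρ) ^ 2 ∂P ≤ (m : ℝ)⁻¹ := by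
  have hm' : (0 : ℝ) < m := by exact_mod_cast hm
  have hi (k : ℕ) : Integrable (C k) P :=
    Integrable.of_bound (hmeas k).aestronglyMeasurable 1 (Eventually.of_forall (hb k))
  have hii (k l : ℕ) : Integrable (fun ω => C k ω * C l ω) P :=
    Integrable.of_bound ((hmeas k).mul (hmeas l)).aestronglyMeasurable 1
      (Eventually.of_forall fun ω => by
        rw [norm_mul]
        exact mul_le_one₀ (hb k ω) (norm_nonneg _) (hb l ω))
  have hp (k l : ℕ) : Integrable (fun ω => (C k ω - ρ) * (C l ω - ρ)) P := by
    have : (fun ω => (C k ω - ρ) * (C l ω - ρ)) =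
        fun ω => C k ω * C l ω - ρ * C k ω - ρ * C l ω + ρ ^ 2 := by
      ext ω
      ring
    rw [this]
    exact (((hii k l).sub ((hi k).const_mul ρ)).sub ((hi l).const_mul ρ)).add (integrable_const _)
  have hcov {k l : ℕ} (hk : k < m) (hl : l < m) : ∫ ω, (C k ω - ρ) * (C l ω - ρ) ∂P =
      ∫ ω, C k ω * C l ω ∂P - ρ ^ 2 := by
    have : (fun ω => (C k ω - ρ) * (C l ω - ρ)) =
        fun ω => C k ω * C l ω - ρ * C k ω - ρ * C l ω + ρ ^ 2 := by
      ext ω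
      ring
    have i1 : Integrable (fun ω => C k ω * C l ω - ρ * C k ω) P :=
      (hii k l).sub ((hi k).const_mul ρ)
    have i2 : Integrable (fun ω => C k ω * C l ω - ρ * C k ω - ρ * C l ω) P :=
      i1.sub ((hi l).const_mul ρ)
    rw [this, integral_add i2 (integrable_const _), integral_sub i1 ((hi l).const_mul ρ),
      integral_sub (hii k l) ((hi k).const_mul ρ), integral_const_mul, integral_const_mul, h1 k hk,
      h1 l hl]
    simp
    ring
  have he : (fun ω => ((m : ℝ)⁻¹ * ∑ k ∈ Finset.range m, C k ω - ρ) ^ 2) = fun ω =>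
      ((m : ℝ)⁻¹) ^ 2 * ∑ k ∈ Finset.range m, ∑ l ∈ Finset.range m, (C k ω - ρ) * (C l ω - ρ) := by
    ext ω
    rw [← Finset.sum_mul_sum, Finset.sum_sub_distrib, Finset.sum_const, Finset.card_range,
      nsmul_eq_mul]
    field_simp
  rw [he, integral_const_mul, integral_finsetSum _
    fun k _ => integrable_finsetSum _ fun l _ => hp k l]
  have hrow : ∀ k ∈ Finset.range m,
      ∫ ω, ∑ l ∈ Finset.range m, (C k ω - ρ) * (C l ω - ρ) ∂P ≤ 1 := by
    intro k hk
    rw [integral_finsetSum _ fun l _ => hp k l, Finset.sum_eq_single_of_mem k hk]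
    · rw [hcov (Finset.mem_range.1 hk) (Finset.mem_range.1 hk)]
      have : ∫ ω, C k ω * C k ω ∂P ≤ ∫ _, (1 : ℝ) ∂P :=
        integral_mono (hii k k) (integrable_const _) fun ω => by
          have := hb k ω
          rw [abs_le] at this
          nlinarith [this.1, this.2]
      simp only [integral_const, probReal_univ, smul_eq_mul, mul_one] at this
      nlinarith [sq_nonneg ρ]
    · intro l hl hlk
      rw [hcov (Finset.mem_range.1 hk) (Finset.mem_range.1 hl),
        h2 k (Finset.mem_range.1 hk) l (Finset.mem_range.1 hl) hlk.symm, sub_self]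
  calc _ ≤ ((m : ℝ)⁻¹) ^ 2 * ∑ k ∈ Finset.range m, (1 : ℝ) := by
        gcongr with k hk
        exact hrow k hk
    _ = _ := by
        simp
        field_simp

/-- Convergence in mean square with summable rate implies almost sure convergence. -/
theorem ae_tendsto_of_summable_integral_sq {Q : ℕ → Ω → ℝ} {ρ : ℝ} (hmeas : ∀ n, Measurable (Q n))
    (hint : ∀ n, Integrable (fun ω => (Q n ω - ρ) ^ 2) P) {c : ℕ → ℝ} (hc : Summable c)
    (hle : ∀ n, ∫ ω, (Q n ω - ρ) ^ 2 ∂P ≤ c n) :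
    ∀ᵐ ω ∂P, Tendsto (fun n => Q n ω) atTop (𝓝 ρ) := by
  have hm (n : ℕ) : Measurable fun ω => ENNReal.ofReal ((Q n ω - ρ) ^ 2) :=
    (((hmeas n).sub_const ρ).pow_const 2).ennreal_ofReal
  have hfin : ∫⁻ ω, ∑' n, ENNReal.ofReal ((Q n ω - ρ) ^ 2) ∂P ≠ ∞ := by
    rw [lintegral_tsum fun n => (hm n).aemeasurable]
    refine ne_top_of_le_ne_top hc.tsum_ofReal_ne_top (ENNReal.tsum_le_tsum fun n => ?_)
    rw [← ofReal_integral_eq_lintegral_ofReal (hint n) (Eventually.of_forall fun _ => sq_nonneg _)]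
    exact ENNReal.ofReal_le_ofReal (hle n)
  filter_upwards [ae_lt_top (Measurable.tsum hm) hfin] with ω hω
  have h0 := ENNReal.tendsto_atTop_zero_of_tsum_ne_top hω.ne
  have h1 := (ENNReal.tendsto_toReal ENNReal.zero_ne_top).comp h0
  have h2 : Tendsto (fun n => (Q n ω - ρ) ^ 2) atTop (𝓝 0) := by
    refine h1.congr fun n => ?_
    exact ENNReal.toReal_ofReal (sq_nonneg _)
  have h3 := h2.sqrt
  simp only [Real.sqrt_sq_eq_abs, Real.sqrt_zero] at h3
  simpa using ((tendsto_zero_iff_abs_tendsto_zero _).2 h3).add_const ρ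

end Probability

/-! ### Increments of Brownian motion -/

namespace IsStdBrownian

variable {Ω : Type*} {mΩ : MeasurableSpace Ω} {d : ℕ} {P : Measure Ω}
  {ℱ : Filtration I mΩ} {B : I → Ω → EuclideanSpace ℝ (Fin d)}
  (u : EuclideanSpace ℝ (Fin d))

theorem measurable (hB : IsStdBrownian P ℱ B)
    (t : I) : Measurable (B t) := (hB.adapted t).mono (ℱ.le t) le_rfl

theorem integral_cexp_increment [IsProbabilityMeasure P] (hB : IsStdBrownian P ℱ B)
    {s t : I} (hst : s ≤ t) (a : ℝ) :
    ∫ ω, Complex.exp ((a * inner ℝ u (B t ω - B s ω) : ℝ) * Complex.I) ∂P =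
      Complex.exp ((-(‖u‖ ^ 2 / 2 * (a ^ 2 * ((t : ℝ) - s))) : ℝ)) := by
  have hm : Measurable fun ω => B t ω - B s ω := (hB.measurable t).sub (hB.measurable s)
  have h1 : ∫ ω, Complex.exp ((a * inner ℝ u (B t ω - B s ω) : ℝ) * Complex.I) ∂P =
      charFun (P.map fun ω => B t ω - B s ω) (a • u) := by
    rw [charFun_apply, integral_map hm.aemeasurable (by fun_prop)]
    simp only [inner_smul_right, real_inner_comm u]
  have hst' : (0 : ℝ) ≤ (t : ℝ) - s := sub_nonneg.2 hst
  rw [h1, hB.law s t hst, charFun_map_smul, charFun_stdGaussian]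
  congr 1
  have h2 : ‖√((t : ℝ) - s) • a • u‖ ^ 2 = ((t : ℝ) - s) * (a ^ 2 * ‖u‖ ^ 2) := by
    rw [norm_smul, norm_smul, mul_pow, mul_pow, Real.norm_eq_abs, Real.norm_eq_abs, sq_abs, sq_abs,
      Real.sq_sqrt hst']
  rw [← Complex.ofReal_pow, h2]
  push_cast
  ring

/-- The characteristic function of a linear combination of successive increments. -/
theorem integral_cexp_sum_increments [IsProbabilityMeasure P] (hB : IsStdBrownian P ℱ B)
    {τ : ℕ → I} (hτ : Monotone τ) (a : ℕ → ℝ) (M : ℕ) :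
    ∫ ω, Complex.exp ((∑ p ∈ Finset.range M, a p * inner ℝ u (B (τ (p + 1)) ω - B (τ p) ω) : ℝ) *
      Complex.I) ∂P = Complex.exp ((-(‖u‖ ^ 2 / 2 *
        ∑ p ∈ Finset.range M, a p ^ 2 * ((τ (p + 1) : ℝ) - τ p)) : ℝ)) := by
  induction M with
  | zero => simp
  | succ M ih =>
    have hinc : Measurable fun ω => B (τ (M + 1)) ω - B (τ M) ω :=
      (hB.measurable _).sub (hB.measurable _)
    have hpast : Measurable[ℱ (τ M)] fun ω =>
        ∑ p ∈ Finset.range M, a p * inner ℝ u (B (τ (p + 1)) ω - B (τ p) ω) := by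
      refine Finset.measurable_fun_sum _ fun p hp => ?_
      have hp' := Finset.mem_range.1 hp
      have h1 : Measurable[ℱ (τ M)] (B (τ (p + 1))) :=
        (hB.adapted _).mono (ℱ.mono (hτ hp')) le_rfl
      have h2 : Measurable[ℱ (τ M)] (B (τ p)) :=
        (hB.adapted _).mono (ℱ.mono (hτ hp'.le)) le_rfl
      have h3 : Measurable fun x : EuclideanSpace ℝ (Fin d) => a p * inner ℝ u x := by fun_prop
      exact h3.comp (h1.sub h2)
    have hind : IndepFun
        (fun ω => ∑ p ∈ Finset.range M, a p * inner ℝ u (B (τ (p + 1)) ω - B (τ p) ω))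
        (fun ω => B (τ (M + 1)) ω - B (τ M) ω) P :=
      (indep_of_indep_of_le_right (hB.indep _ _ (hτ M.le_succ)) hpast.comap_le).symm
    have hf : Measurable fun x : ℝ => Complex.exp ((x : ℂ) * Complex.I) := by fun_prop
    have hg : Measurable fun x : EuclideanSpace ℝ (Fin d) =>
        Complex.exp ((a M * inner ℝ u x : ℝ) * Complex.I) := by fun_prop
    have hmul := (hind.comp hf hg).integral_fun_mul_eq_mul_integral
      (hf.comp (hpast.mono (ℱ.le _) le_rfl)).aestronglyMeasurable
      (hg.comp hinc).aestronglyMeasurable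
    simp only [Function.comp_def] at hmul
    rw [ih, hB.integral_cexp_increment u (hτ M.le_succ), ← Complex.exp_add] at hmul
    simp only [Finset.sum_range_succ]
    calc _ = _ := by
          refine integral_congr_ae (Eventually.of_forall fun ω => ?_)
          simp only []
          rw [Complex.ofReal_add, add_mul, Complex.exp_add]
      _ = _ := hmul
      _ = _ := by
          congr 1
          push_cast
          ring

theorem integral_cos_sum_increments [IsProbabilityMeasure P] (hB : IsStdBrownian P ℱ B)
    {τ : ℕ → I} (hτ : Monotone τ) (a : ℕ → ℝ) (M : ℕ) :
    ∫ ω, Real.cos (∑ p ∈ Finset.range M, a p * inner ℝ u (B (τ (p + 1)) ω - B (τ p) ω)) ∂P =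
      Real.exp (-(‖u‖ ^ 2 / 2 *
        ∑ p ∈ Finset.range M, a p ^ 2 * ((τ (p + 1) : ℝ) - τ p))) := by
  have hm : Measurable fun ω =>
      ∑ p ∈ Finset.range M, a p * inner ℝ u (B (τ (p + 1)) ω - B (τ p) ω) := by
    refine Finset.measurable_fun_sum _ fun p _ => ?_
    have h3 : Measurable fun x : EuclideanSpace ℝ (Fin d) => a p * inner ℝ u x := by fun_prop
    exact h3.comp ((hB.measurable _).sub (hB.measurable _))
  have hi : Integrable (fun ω => Complex.exp
      ((∑ p ∈ Finset.range M, a p * inner ℝ u (B (τ (p + 1)) ω - B (τ p) ω) : ℝ) * Complex.I)) P :=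
    Integrable.of_bound (C := 1) ((by fun_prop : Measurable fun x : ℝ =>
      Complex.exp ((x : ℂ) * Complex.I)).comp hm).aestronglyMeasurable
      (Eventually.of_forall fun ω => (Complex.norm_exp_ofReal_mul_I _).le)
  have h := congrArg Complex.re (hB.integral_cexp_sum_increments u hτ a M)
  rw [Complex.exp_ofReal_re] at h
  rw [← h]
  have h2 := integral_re hi
  simp only [RCLike.re_eq_complex_re, Complex.exp_ofReal_mul_I_re] at h2
  exact h2

/-- The Riemann sum with `N + 1` points of `θ ∫ ⟨u, B_t - B_r⟩ dr` over `[k 2⁻ⁿ, (k + 1) 2⁻ⁿ]`,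
where `t` is the right end point and `θ = 2^{3n/2}` normalises the variance. It is written as a
weighted sum of increments, which makes the blocks `k` visibly independent. -/
def _root_.weightedBlock (B : I → Ω → EuclideanSpace ℝ (Fin d)) (u : EuclideanSpace ℝ (Fin d))
    (n N k : ℕ) (ω : Ω) : ℝ :=
  √2 ^ (3 * n) * ((2 ^ n)⁻¹ / (N + 1)) * ∑ q ∈ Finset.range (N + 1), ((q : ℝ) + 1) *
    inner ℝ u (B (Set.projIcc 0 1 zero_le_one
        (((k * (N + 1) + q + 1 : ℕ) : ℝ) / (2 ^ n * (N + 1)))) ω -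
      B (Set.projIcc 0 1 zero_le_one (((k * (N + 1) + q : ℕ) : ℝ) / (2 ^ n * (N + 1)))) ω)

theorem measurable_weightedBlock (hB : IsStdBrownian P ℱ B)
    (n N k : ℕ) : Measurable (weightedBlock B u n N k) := by
  refine Measurable.const_mul (Finset.measurable_fun_sum _ fun q _ => ?_) _
  have h3 : Measurable fun x : EuclideanSpace ℝ (Fin d) => ((q : ℝ) + 1) * inner ℝ u x := by
    fun_prop
  exact h3.comp ((hB.measurable _).sub (hB.measurable _))

theorem integral_cos_sum_weightedBlock [IsProbabilityMeasure P] (hB : IsStdBrownian P ℱ B)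
    (n N : ℕ) (c : ℕ → ℝ) :
    ∫ ω, Real.cos (∑ k ∈ Finset.range (2 ^ n), c k * weightedBlock B u n N k ω) ∂P =
      Real.exp (-(‖u‖ ^ 2 / 2 * ((1 + 1 / ((N : ℝ) + 1)) * (2 + 1 / ((N : ℝ) + 1)) / 6) *
        ∑ k ∈ Finset.range (2 ^ n), c k ^ 2)) := by
  have hN : (0 : ℝ) < N + 1 := by positivity
  have hM : (0 : ℝ) < 2 ^ n * (N + 1) := by positivity
  set τ : ℕ → I := fun p => Set.projIcc 0 1 zero_le_one ((p : ℝ) / (2 ^ n * (N + 1))) with hτ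
  have hmono : Monotone τ := fun p q hpq => Set.monotone_projIcc _ (by gcongr)
  have hcoe {p : ℕ} (hp : p ≤ 2 ^ n * (N + 1)) : (τ p : ℝ) = p / (2 ^ n * (N + 1)) := by
    have h : (p : ℝ) / (2 ^ n * (N + 1)) ∈ Set.Icc (0 : ℝ) 1 :=
      ⟨by positivity, div_le_one_of_le₀ (by exact_mod_cast hp) hM.le⟩
    simp only [hτ]
    rw [Set.projIcc_of_mem _ h]
  set γ : ℝ := √2 ^ (3 * n) * ((2 ^ n)⁻¹ / (N + 1)) with hγ
  set a : ℕ → ℝ := fun p => c (p / (N + 1)) * (γ * (((p % (N + 1) : ℕ) : ℝ) + 1)) with ha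
  have hdiv (k : ℕ) {q : ℕ} (hq : q < N + 1) :
      a (k * (N + 1) + q) = c k * (γ * ((q : ℝ) + 1)) := by
    have h1 : (k * (N + 1) + q) / (N + 1) = k := by
      rw [Nat.mul_comm, Nat.mul_add_div (Nat.succ_pos N), Nat.div_eq_of_lt hq, add_zero]
    have h2 : (k * (N + 1) + q) % (N + 1) = q := by
      rw [Nat.mul_comm, Nat.mul_add_mod, Nat.mod_eq_of_lt hq]
    simp only [ha, h1, h2]
  have key := hB.integral_cos_sum_increments u hmono a (2 ^ n * (N + 1))
  have hL (ω : Ω) : ∑ p ∈ Finset.range (2 ^ n * (N + 1)),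
      a p * inner ℝ u (B (τ (p + 1)) ω - B (τ p) ω) =
        ∑ k ∈ Finset.range (2 ^ n), c k * weightedBlock B u n N k ω := by
    rw [Finset.sum_range_mul_block]
    refine Finset.sum_congr rfl fun k _ => ?_
    rw [weightedBlock, ← hγ, Finset.mul_sum, Finset.mul_sum]
    refine Finset.sum_congr rfl fun q hq => ?_
    rw [hdiv k (Finset.mem_range.1 hq)]
    ring
  have hθ : (√2 ^ (3 * n)) ^ 2 = ((2 : ℝ) ^ n) ^ 3 := by
    rw [← pow_mul, mul_comm, pow_mul, Real.sq_sqrt zero_le_two, ← pow_mul, mul_comm]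
  have hR : ∑ p ∈ Finset.range (2 ^ n * (N + 1)), a p ^ 2 * ((τ (p + 1) : ℝ) - τ p) =
      (1 + 1 / ((N : ℝ) + 1)) * (2 + 1 / ((N : ℝ) + 1)) / 6 *
        ∑ k ∈ Finset.range (2 ^ n), c k ^ 2 := by
    have h1 : ∀ p ∈ Finset.range (2 ^ n * (N + 1)), a p ^ 2 * ((τ (p + 1) : ℝ) - τ p) =
        a p ^ 2 * (1 / (2 ^ n * (N + 1))) := by
      intro p hp
      have hp' := Finset.mem_range.1 hp
      rw [hcoe hp', hcoe hp'.le]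
      push_cast
      ring
    rw [Finset.sum_congr rfl h1, Finset.sum_range_mul_block, Finset.mul_sum]
    refine Finset.sum_congr rfl fun k _ => ?_
    have h2 : ∀ q ∈ Finset.range (N + 1), a (k * (N + 1) + q) ^ 2 * (1 / (2 ^ n * ((N : ℝ) + 1))) =
        c k ^ 2 * γ ^ 2 / (2 ^ n * ((N : ℝ) + 1)) * ((q : ℝ) + 1) ^ 2 := by
      intro q hq
      rw [hdiv k (Finset.mem_range.1 hq)]
      ring
    rw [Finset.sum_congr rfl h2, ← Finset.mul_sum, sum_range_succ_sq, hγ, mul_pow, hθ]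
    push_cast
    field_simp
  simp only [hL, hR] at key
  rw [key]
  congr 1
  ring

theorem integral_cos_weightedBlock [IsProbabilityMeasure P] (hB : IsStdBrownian P ℱ B)
    {n k : ℕ} (hk : k < 2 ^ n) (N : ℕ) :
    ∫ ω, Real.cos (weightedBlock B u n N k ω) ∂P =
      Real.exp (-(‖u‖ ^ 2 / 2 * ((1 + 1 / ((N : ℝ) + 1)) * (2 + 1 / ((N : ℝ) + 1)) / 6))) := by
  have h := hB.integral_cos_sum_weightedBlock u n N fun j => if j = k then 1 else 0
  have hk' := Finset.mem_range.2 hk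
  simpa [hk, ite_pow, ite_mul] using h

theorem integral_cos_mul_cos_weightedBlock [IsProbabilityMeasure P] (hB : IsStdBrownian P ℱ B)
    {n k l : ℕ} (hk : k < 2 ^ n) (hl : l < 2 ^ n)
    (hkl : k ≠ l) (N : ℕ) :
    ∫ ω, Real.cos (weightedBlock B u n N k ω) * Real.cos (weightedBlock B u n N l ω) ∂P =
      Real.exp (-(‖u‖ ^ 2 / 2 *
        ((1 + 1 / ((N : ℝ) + 1)) * (2 + 1 / ((N : ℝ) + 1)) / 6))) ^ 2 := by
  have hk' := Finset.mem_range.2 hk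
  have hl' := Finset.mem_range.2 hl
  have hpm {ε : ℝ} (hε : ε ^ 2 = 1) :
      ∫ ω, Real.cos (weightedBlock B u n N k ω + ε * weightedBlock B u n N l ω) ∂P =
        Real.exp (-(‖u‖ ^ 2 / 2 *
          ((1 + 1 / ((N : ℝ) + 1)) * (2 + 1 / ((N : ℝ) + 1)) / 6))) ^ 2 := by
    have h := hB.integral_cos_sum_weightedBlock u n N
      fun j => (if j = k then 1 else 0) + if j = l then ε else 0
    have hsq (j : ℕ) : ((if j = k then (1 : ℝ) else 0) + if j = l then ε else 0) ^ 2 =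
        (if j = k then 1 else 0) + if j = l then 1 else 0 := by
      by_cases h1 : j = k
      · have h2 : j ≠ l := fun h2 => hkl (h1.symm.trans h2)
        simp [h1, hkl]
      · by_cases h2 : j = l
        · rw [if_neg h1, if_pos h2, if_pos h2, zero_add, hε, zero_add]
        · simp [h1, h2]
    simp only [hsq, add_mul, Finset.sum_add_distrib, ite_mul, one_mul, zero_mul,
      Finset.sum_ite_eq', hk', hl', if_true] at h
    rw [h, ← Real.exp_nat_mul]
    congr 1
    push_cast
    ring
  have hm := hB.measurable_weightedBlock u n N
  have hi (ε : ℝ) : Integrable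
      (fun ω => Real.cos (weightedBlock B u n N k ω + ε * weightedBlock B u n N l ω)) P :=
    Integrable.of_bound (C := 1)
      ((hm k).add ((hm l).const_mul ε)).cos.aestronglyMeasurable
      (Eventually.of_forall fun ω => Real.abs_cos_le_one _)
  have he : (fun ω => Real.cos (weightedBlock B u n N k ω) * Real.cos (weightedBlock B u n N l ω)) =
      fun ω => (1 / 2 : ℝ) *
        (Real.cos (weightedBlock B u n N k ω + 1 * weightedBlock B u n N l ω) +
          Real.cos (weightedBlock B u n N k ω + (-1) * weightedBlock B u n N l ω)) := by
    ext ω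
    rw [one_mul, neg_one_mul, Real.cos_add, ← sub_eq_add_neg, Real.cos_sub]
    ring
  rw [he, integral_const_mul, integral_add (hi 1) (hi (-1)), hpm (one_pow 2), hpm (by norm_num)]
  ring

/-! ### Divergence of the vertical discrepancies -/

theorem tendsto_weightedBlock (hB : IsStdBrownian P ℱ B)
    {n k : ℕ} (hk : k < 2 ^ n) (ω : Ω) :
    Tendsto (fun N => weightedBlock B u n N k ω) atTop (𝓝 (√2 ^ (3 * n) *
      ∫ r in (StepTwoCarnot.dyadic n k : ℝ)..StepTwoCarnot.dyadic n (k + 1),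
        inner ℝ u (pathExt (fun t => B t ω) (StepTwoCarnot.dyadic n (k + 1)) -
          pathExt (fun t => B t ω) r))) := by
  have hs := StepTwoCarnot.coe_dyadic (n := n) hk.le
  have ht := StepTwoCarnot.coe_dyadic (n := n) (k := k + 1) hk
  have hst : (StepTwoCarnot.dyadic n (k + 1) : ℝ) = StepTwoCarnot.dyadic n k + (2 ^ n)⁻¹ := by
    rw [hs, ht]
    push_cast
    ring
  have hc : Continuous (pathExt fun t => B t ω) := (hB.continuous ω).Icc_extend'
  have hg : Continuous fun r => inner ℝ u (pathExt (fun t => B t ω)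
      (StepTwoCarnot.dyadic n (k + 1)) - pathExt (fun t => B t ω) r) := by fun_prop
  have hlim := (tendsto_riemann_sum hg (StepTwoCarnot.dyadic n k) (δ := (2 ^ n)⁻¹)
    (by positivity)).const_mul (√2 ^ (3 * n))
  rw [← hst] at hlim
  refine hlim.congr fun N => ?_
  have hN : (N : ℝ) + 1 ≠ 0 := by positivity
  rw [weightedBlock, mul_assoc]
  congr 2
  set f : ℕ → ℝ := fun q => inner ℝ u (B (Set.projIcc 0 1 zero_le_one
    (((k * (N + 1) + q : ℕ) : ℝ) / (2 ^ n * (N + 1)))) ω) with hf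
  have h := sum_range_weighted_increments f (N + 1)
  simp only [inner_sub_right]
  refine Eq.trans ?_ h.symm
  refine Finset.sum_congr rfl fun q _ => ?_
  have hpe (r : ℝ) : pathExt (fun t => B t ω) r = B (Set.projIcc 0 1 zero_le_one r) ω := rfl
  have e1 : (StepTwoCarnot.dyadic n (k + 1) : ℝ) =
      ((k * (N + 1) + (N + 1) : ℕ) : ℝ) / (2 ^ n * (N + 1)) := by
    rw [ht]
    push_cast
    field_simp
  have e2 : (StepTwoCarnot.dyadic n k : ℝ) + (2 ^ n)⁻¹ * (q / (N + 1)) =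
      ((k * (N + 1) + q : ℕ) : ℝ) / (2 ^ n * (N + 1)) := by
    rw [hs]
    push_cast
    field_simp
  rw [e2, e1, hpe, hpe]

/-- The sums of the normalised areas `∫ ⟨u, B_t - B_r⟩ dr` over dyadic intervals diverge. The
elementary bound `|x| ≥ 1 - cos x` reduces this to the concentration of bounded variables. -/
theorem ae_tendsto_sum_abs_integral [IsProbabilityMeasure P] (hB : IsStdBrownian P ℱ B)
    (hu : u ≠ 0) :
    ∀ᵐ ω ∂P, Tendsto (fun n : ℕ => 2 ^ n * ∑ k ∈ Finset.range (2 ^ n),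
      |∫ r in (StepTwoCarnot.dyadic n k : ℝ)..StepTwoCarnot.dyadic n (k + 1),
        inner ℝ u (pathExt (fun t => B t ω) (StepTwoCarnot.dyadic n (k + 1)) -
          pathExt (fun t => B t ω) r)|) atTop atTop := by
  set ξ : ℕ → ℕ → Ω → ℝ := fun n k ω =>
    ∫ r in (StepTwoCarnot.dyadic n k : ℝ)..StepTwoCarnot.dyadic n (k + 1),
      inner ℝ u (pathExt (fun t => B t ω) (StepTwoCarnot.dyadic n (k + 1)) -
        pathExt (fun t => B t ω) r) with hξ
  set Q : ℕ → Ω → ℝ := fun n ω => ((2 ^ n : ℕ) : ℝ)⁻¹ *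
    ∑ k ∈ Finset.range (2 ^ n), Real.cos (√2 ^ (3 * n) * ξ n k ω) with hQ
  set QN : ℕ → ℕ → Ω → ℝ := fun n N ω => ((2 ^ n : ℕ) : ℝ)⁻¹ *
    ∑ k ∈ Finset.range (2 ^ n), Real.cos (weightedBlock B u n N k ω) with hQN
  set ρ : ℝ := Real.exp (-(‖u‖ ^ 2 / 2 * (1 * 2 / 6))) with hρ
  set ρN : ℕ → ℝ := fun N => Real.exp (-(‖u‖ ^ 2 / 2 *
    ((1 + 1 / ((N : ℝ) + 1)) * (2 + 1 / ((N : ℝ) + 1)) / 6))) with hρN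
  have hρ1 : ρ < 1 := by
    rw [hρ, Real.exp_lt_one_iff]
    have := norm_pos_iff.2 hu
    have : 0 < ‖u‖ ^ 2 / 2 * (1 * 2 / 6) := by positivity
    linarith
  have hρlim : Tendsto ρN atTop (𝓝 ρ) := by
    have h0 := tendsto_one_div_add_atTop_nhds_zero_nat (𝕜 := ℝ)
    have h1 := ((((h0.const_add 1).mul (h0.const_add 2)).div_const 6).const_mul
      (‖u‖ ^ 2 / 2)).neg.rexp
    simpa only [add_zero] using h1
  have hQm (n N : ℕ) : Measurable (QN n N) :=
    Measurable.const_mul (Finset.measurable_fun_sum _ fun k _ =>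
      (hB.measurable_weightedBlock u n N k).cos) _
  have hlim (n : ℕ) (ω : Ω) : Tendsto (fun N => QN n N ω) atTop (𝓝 (Q n ω)) := by
    refine (tendsto_finsetSum _ fun k hk => ?_).const_mul _
    exact (Real.continuous_cos.tendsto _).comp
      (hB.tendsto_weightedBlock u (Finset.mem_range.1 hk) ω)
  have hQmeas (n : ℕ) : Measurable (Q n) :=
    measurable_of_tendsto_metrizable (hQm n) (tendsto_pi_nhds.2 (hlim n))
  have hmean (n : ℕ) (x : ℕ → ℝ) :
      |((2 ^ n : ℕ) : ℝ)⁻¹ * ∑ k ∈ Finset.range (2 ^ n), Real.cos (x k)| ≤ 1 := by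
    have h2 : (0 : ℝ) < ((2 ^ n : ℕ) : ℝ) := by positivity
    rw [abs_mul, abs_of_pos (inv_pos.2 h2), inv_mul_le_iff₀ h2, mul_one]
    refine (Finset.abs_sum_le_sum_abs _ _).trans ?_
    refine (Finset.sum_le_sum fun k _ => Real.abs_cos_le_one (x k)).trans ?_
    simp
  have hbound {q r : ℝ} (hq : |q| ≤ 1) (hr0 : 0 ≤ r) (hr1 : r ≤ 1) : ‖(q - r) ^ 2‖ ≤ 4 := by
    rw [abs_le] at hq
    rw [Real.norm_of_nonneg (sq_nonneg _)]
    nlinarith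
  have hρN1 (N : ℕ) : ρN N ≤ 1 := by
    rw [hρN, Real.exp_le_one_iff]
    have : (0 : ℝ) ≤ ‖u‖ ^ 2 / 2 * ((1 + 1 / ((N : ℝ) + 1)) * (2 + 1 / ((N : ℝ) + 1)) / 6) := by
      positivity
    linarith
  have hvarN (n N : ℕ) : ∫ ω, (QN n N ω - ρN N) ^ 2 ∂P ≤ ((2 ^ n : ℕ) : ℝ)⁻¹ :=
    integral_sq_mean_sub_le (by positivity) (fun k ω => Real.cos (weightedBlock B u n N k ω))
      (fun k => (hB.measurable_weightedBlock u n N k).cos) (fun k ω => Real.abs_cos_le_one _)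
      (fun k hk => hB.integral_cos_weightedBlock u hk N)
      fun k hk l hl hkl => hB.integral_cos_mul_cos_weightedBlock u hk hl hkl N
  have hvar (n : ℕ) : ∫ ω, (Q n ω - ρ) ^ 2 ∂P ≤ ((2 ^ n : ℕ) : ℝ)⁻¹ := by
    have h : Tendsto (fun N => ∫ ω, (QN n N ω - ρN N) ^ 2 ∂P) atTop
        (𝓝 (∫ ω, (Q n ω - ρ) ^ 2 ∂P)) := by
      refine tendsto_integral_of_dominated_convergence (fun _ => 4)
        (fun N => (((hQm n N).sub_const _).pow_const 2).aestronglyMeasurable)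
        (integrable_const _) (fun N => Eventually.of_forall fun ω => ?_)
        (Eventually.of_forall fun ω => ((hlim n ω).sub hρlim).pow 2)
      exact hbound (hmean n _) (Real.exp_pos _).le (hρN1 N)
    exact le_of_tendsto' h (hvarN n)
  have hsum : Summable fun n : ℕ => ((2 ^ n : ℕ) : ℝ)⁻¹ := by
    simpa using summable_geometric_two
  have hae := ae_tendsto_of_summable_integral_sq (P := P) (ρ := ρ) hQmeas (fun n =>
    Integrable.of_bound (C := 4) (((hQmeas n).sub_const _).pow_const 2).aestronglyMeasurable
      (Eventually.of_forall fun ω => hbound (hmean n _) (Real.exp_pos _).le hρ1.le)) hsum hvar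
  filter_upwards [hae] with ω hω
  have hgrow : Tendsto (fun n : ℕ => √2 ^ n * (1 - Q n ω)) atTop atTop :=
    (tendsto_pow_atTop_atTop_of_one_lt (Real.lt_sqrt_of_sq_lt (by norm_num))).atTop_mul_pos
      (sub_pos.2 hρ1) (hω.const_sub 1)
  refine tendsto_atTop_mono (fun n => ?_) hgrow
  have h2 : (0 : ℝ) < 2 ^ n := by positivity
  have hr : 0 < √2 := by positivity
  have hθ : 0 < √2 ^ (3 * n) := by positivity
  have hcos (x : ℝ) : 1 - Real.cos x ≤ |x| := by
    rcases le_total |x| 2 with h | h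
    · have h1 := Real.one_sub_sq_div_two_le_cos (x := x)
      have h3 := abs_nonneg x
      rw [← sq_abs] at h1
      nlinarith
    · linarith [Real.neg_one_le_cos x]
  have hk (k : ℕ) : 1 - Real.cos (√2 ^ (3 * n) * ξ n k ω) ≤ √2 ^ (3 * n) * |ξ n k ω| := by
    refine (hcos _).trans_eq ?_
    rw [abs_mul, abs_of_pos hθ]
  have hs : √2 ^ n * √2 ^ (3 * n) = (2 : ℝ) ^ n * 2 ^ n := by
    rw [← pow_add, show n + 3 * n = 2 * (2 * n) by ring, pow_mul, Real.sq_sqrt zero_le_two,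
      two_mul, pow_add]
  have hsumk := Finset.sum_le_sum fun k (_ : k ∈ Finset.range (2 ^ n)) => hk k
  rw [Finset.sum_sub_distrib, ← Finset.mul_sum, Finset.sum_const, Finset.card_range,
    nsmul_eq_mul, mul_one] at hsumk
  have hQe : (2 : ℝ) ^ n * Q n ω =
      ∑ k ∈ Finset.range (2 ^ n), Real.cos (√2 ^ (3 * n) * ξ n k ω) := by
    simp only [hQ]
    push_cast
    rw [← mul_assoc, mul_inv_cancel₀ h2.ne', one_mul]
  rw [← hQe] at hsumk
  push_cast at hsumk
  refine le_of_mul_le_mul_right ?_ hθ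
  calc √2 ^ n * (1 - Q n ω) * √2 ^ (3 * n) = 2 ^ n * (2 ^ n - 2 ^ n * Q n ω) := by
        linear_combination (1 - Q n ω) * hs
    _ ≤ 2 ^ n * (√2 ^ (3 * n) * ∑ k ∈ Finset.range (2 ^ n), |ξ n k ω|) := by gcongr
    _ = _ := by ring

end IsStdBrownian

end

theorem proposition5p10 {d₁ d₂ : ℕ} [NeZero d₁] (G : StepTwoCarnot d₁ d₂)
    {Ω : Type*} [mΩ : MeasurableSpace Ω] (P : Measure Ω) [IsProbabilityMeasure P]
    (ℱ : Filtration unitInterval mΩ) (Y : Ω → G.PathSpace) (hY : G.IsBrownian P ℱ Y) :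
    ((∃ j, G.w 0 j ≠ 0) →
      (∀ᵐ ω ∂P, Tendsto
        (fun n => G.discCost n (Y ω) (G.shift (firstCoordPath d₁) (Y ω))) atTop atTop) ∧
      ∀ ω, G.cost (Y ω) (G.shift (firstCoordPath d₁) (Y ω)) = 1) ∧
    ∃ ω η : G.PathSpace,
      ¬ Tendsto (fun n => ENNReal.ofReal (G.discCost n ω η)) atTop (𝓝 (G.cost ω η)) := by
  refine ⟨fun ⟨j, hj⟩ => ⟨?_, fun ω => ?_⟩, G.exists_not_tendsto_discCost⟩
  · obtain ⟨m, hm⟩ : ∃ m, G.w 0 j m ≠ 0 := by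
      by_contra! h
      exact hj (PiLp.ext h)
    set v : EuclideanSpace ℝ (Fin d₁) := EuclideanSpace.single 0 1 with hv
    -- The vector `u` represents the linear form `x ↦ [V₁, x]_m`, which is not zero.
    set L : EuclideanSpace ℝ (Fin d₁) →L[ℝ] ℝ :=
      (EuclideanSpace.proj m : EuclideanSpace ℝ (Fin d₂) →L[ℝ] ℝ).comp (G.bracketCLM v) with hL
    set u := (InnerProductSpace.toDual ℝ (EuclideanSpace ℝ (Fin d₁))).symm L with hu
    have hLu (x : EuclideanSpace ℝ (Fin d₁)) : inner ℝ u x = G.bracketCLM v x m :=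
      InnerProductSpace.toDual_symm_apply
    have hu0 : u ≠ 0 := by
      intro h0
      have h := hLu (EuclideanSpace.single j 1)
      rw [h0, inner_zero_left, hv, G.bracketCLM_single, one_mul, one_smul] at h
      exact hm h.symm
    have hK := G.norm_bracketCLM_pos
    filter_upwards [hY.1.ae_tendsto_sum_abs_integral u hu0] with ω hω
    have hlow : Tendsto (fun n => √(2 / ‖G.bracketCLM‖ * (2 ^ n * ∑ k ∈ Finset.range (2 ^ n),
        |∫ r in (StepTwoCarnot.dyadic n k : ℝ)..StepTwoCarnot.dyadic n (k + 1),
          inner ℝ u (pathExt (fun t => ((Y ω).1 t).1) (StepTwoCarnot.dyadic n (k + 1)) -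
            pathExt (fun t => ((Y ω).1 t).1) r)|))) atTop atTop :=
      Real.tendsto_sqrt_atTop.comp (hω.const_mul_atTop (by positivity))
    refine tendsto_atTop_mono (fun n => Real.sqrt_le_iff.2 ⟨Real.sqrt_nonneg _, ?_⟩) hlow
    have hsum := G.sum_norm_vert_le_discCost n (Y ω) (G.shift (firstCoordPath d₁) (Y ω))
    have hterm (k : ℕ) : |∫ r in (StepTwoCarnot.dyadic n k : ℝ)..StepTwoCarnot.dyadic n (k + 1),
        inner ℝ u (pathExt (fun t => ((Y ω).1 t).1) (StepTwoCarnot.dyadic n (k + 1)) -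
          pathExt (fun t => ((Y ω).1 t).1) r)| ≤
        ‖G.vert (G.increment (Y ω) (StepTwoCarnot.dyadic n k) (StepTwoCarnot.dyadic n (k + 1)))
          (G.increment (G.shift (firstCoordPath d₁) (Y ω)) (StepTwoCarnot.dyadic n k)
            (StepTwoCarnot.dyadic n (k + 1)))‖ := by
      rw [firstCoordPath_eq, G.vert_increment_shift, ← hv]
      have hc : Continuous fun r => G.bracketCLM v
          (pathExt (G.horPart (Y ω)) (StepTwoCarnot.dyadic n (k + 1)) -
            pathExt (G.horPart (Y ω)) r) :=
        (G.bracketCLM v).continuous.comp (continuous_const.sub (continuous_pathExt _))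
      have hcomm := (EuclideanSpace.proj (𝕜 := ℝ) m).intervalIntegral_comp_comm
        (hc.intervalIntegrable (μ := volume) (StepTwoCarnot.dyadic n k)
          (StepTwoCarnot.dyadic n (k + 1)))
      simp only [hLu]
      refine le_of_eq_of_le (congrArg abs hcomm) ?_
      exact PiLp.norm_apply_le
        (∫ r in (StepTwoCarnot.dyadic n k : ℝ)..StepTwoCarnot.dyadic n (k + 1),
        G.bracketCLM v (pathExt (G.horPart (Y ω)) (StepTwoCarnot.dyadic n (k + 1)) -
          pathExt (G.horPart (Y ω)) r)) m
    calc _ ≤ 2 / ‖G.bracketCLM‖ * (‖G.bracketCLM‖ / 2 *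
          G.discCost n (Y ω) (G.shift (firstCoordPath d₁) (Y ω)) ^ 2) := by
          refine mul_le_mul_of_nonneg_left (le_trans ?_ hsum) (by positivity)
          gcongr with k _
          exact hterm k
      _ = _ := by field_simp
  · rw [firstCoordPath_eq, G.cost_shift (linPath_mem_cameronMartin _), cameronMartinNorm_linPath]
    simp
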